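/- Let $\alpha>-1$, $\nu>0$, $\lambda,t\ge 0$, $\lambda^2+t^2\neq0$, $n\in\mathbb N=\{1,2,\dots\}$. Let $\rho_\nu(x)=2x^{\nu/2}K_\nu(2\sqrt x)$ for $x>0$, where $K_\nu$ is the modified Bessel function, and $\rho_\nu(0)=\Gamma(\nu)$. Let $P_m(x)=P_m(x;\lambda,t)=a_mx^m+b_mx^{m-1}+\dots$ ($m\ge 0$, $b_0=0$) be the orthonormal polynomials of the weight $x^\alpha e^{-\lambda x}\rho_\nu(xt)$ on $(0,\infty)$, with the sign of the leading coefficient normalized by $(-1)^m a_m>0$; that is, $\deg P_m=m$ and $$\int_0^\infty P_m(x;\lambda,t)P_k(x;\lambda,t)\,e^{-\lambda x}\rho_\nu(xt)\,x^\alpha\,dx=\delta_{m,k}\qquad(m,k\ge0).$$ (These integrals converge, and such polynomials exist.) Put $A_m=a_{m-1}/a_m$ for $m\ge 1$ and $B_m=\dfrac{b_m}{a_m}-\dfrac{b_{m+1}}{a_{m+1}}$; $a_m,b_m,A_m,B_m$ are functions of $(\lambda,t)$. For $\lambda>0$ let $$\hat L_n^\alpha(x;\lambda)=\lambda^{(1+\alpha)/2}\left(\frac{n!}{\Gamma(n+\alpha+1)\Gamma(\nu)}\right)^{1/2}L_n^\alpha(\lambda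 x),$$ where $L_n^\alpha$ is the associated Laguerre polynomial. Then, for all real $x$: (i) If $t>0$, then $$P_n(x;\lambda,t)=\int_0^\lambda\exp\left(\tfrac12\int_\xi^\lambda B_n(y,t)\,dy\right)A_n(\xi,t)P_{n-1}(x;\xi,t)\,d\xi+\exp\left(\tfrac12\int_0^\lambda B_n(y,t)\,dy\right)P_n(x;0,t),$$ where the function $B_n(\cdot,t)$ and the integrand of the outer integral are integrable on $[0,\lambda]$. (ii) If $\lambda>0$, then $P_n(x;\lambda,0)=\hat L_n^\alpha(x;\lambda)$, $$a_n(\lambda,0)=\frac{(-1)^n\lambda^{n+(1+\alpha)/2}}{\left(n!\,\Gamma(n+\alpha+1)\Gamma(\nu)\right)^{1/2}},$$ and $$P_n(x;\lambda,t)=a_n(\lambda,t)\int_0^t\left[x\frac{\partial}{\partial x}P_n(x;\lambda,y)-nP_n(x;\lambda,y)-\lambda A_n(\lambda,y)P_{n-1}(x;\lambda,y)\right]\frac{dy}{y\,a_n(\lambda,y)}$$ $$+(-1)^n\lambda^{-n-(1+\alpha)/2}\left[n!\,\Gamma(n+\alpha+1)\Gamma(\nu)\right]^{1/2}a_n(\lambda,t)\,\hat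 L_n^\alpha(x;\lambda),$$ where the integrand is integrable on $(0,t)$. -/

import Mathlib

open MeasureTheory

open scoped Polynomial Nat

namespace PrudnikovLaguerre

noncomputable section

/-- The modified Bessel (Macdonald) function `K_ν(z)` for `z > 0`, by its classical integral
`K_ν(z) = ∫_0^∞ e^{-z cosh u} cosh (ν u) du`. -/
def macdonaldK (ν z : ℝ) : ℝ :=
  ∫ u in Set.Ioi (0 : ℝ), Real.exp (-z * Real.cosh u) * Real.cosh (ν * u)

/-- `ρ_ν(x) = 2 x^{ν/2} K_ν(2 √x)` for `x > 0`, and `ρ_ν(0) = Γ(ν)` (the limit value for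
`ν > 0`). -/
def rho (ν x : ℝ) : ℝ :=
  if x = 0 then Real.Gamma ν else 2 * x ^ (ν / 2) * macdonaldK ν (2 * Real.sqrt x)

/-- The weight `x^α e^{-l x} ρ_ν(x t)` on `(0, ∞)`. -/
def weight (α ν l t x : ℝ) : ℝ :=
  x ^ α * Real.exp (-l * x) * rho ν (x * t)

/-- The functional `q ↦ ∫_0^∞ q(x) x^α e^{-l x} ρ_ν(x t) dx` on polynomials. -/
def functional (α ν l t : ℝ) (q : ℝ[X]) : ℝ :=
  ∫ x in Set.Ioi (0 : ℝ), q.eval x * weight α ν l t x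

/-- The monic orthogonal polynomials of the weight: Gram-Schmidt applied to `1, x, x², …`. -/
def monicP (α ν l t : ℝ) (n : ℕ) : ℝ[X] :=
  Polynomial.X ^ n - ∑ k : Fin n,
    Polynomial.C
      (functional α ν l t (Polynomial.X ^ n * monicP α ν l t k) /
        functional α ν l t (monicP α ν l t k ^ 2)) *
      monicP α ν l t k
termination_by n
decreasing_by all_goals exact k.isLt

/-- The orthonormal polynomials `P_n(x; l, t)` of the weight, with leading coefficient of
sign `(-1)^n`. -/
def P (α ν l t : ℝ) (n : ℕ) : ℝ[X] :=
  Polynomial.C ((-1) ^ n / Real.sqrt (functional α ν l t (monicP α ν l t n ^ 2))) *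
    monicP α ν l t n

/-- `a_n(l, t)`, the coefficient of `x^n` in `P_n(x; l, t)`. -/
def a (α ν l t : ℝ) (n : ℕ) : ℝ := (P α ν l t n).coeff n

/-- `b_n(l, t)`, the coefficient of `x^{n-1}` in `P_n(x; l, t)` (zero for `n = 0`). -/
def b (α ν l t : ℝ) : ℕ → ℝ
  | 0 => 0
  | n + 1 => (P α ν l t (n + 1)).coeff n

/-- The recurrence coefficient `A_n = a_{n-1} / a_n` (with `a_{-1} = 0`). -/
def A (α ν l t : ℝ) : ℕ → ℝ
  | 0 => 0
  | n + 1 => a α ν l t n / a α ν l t (n + 1)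

/-- The recurrence coefficient `B_n = b_n / a_n - b_{n+1} / a_{n+1}`. -/
def B (α ν l t : ℝ) (n : ℕ) : ℝ :=
  b α ν l t n / a α ν l t n - b α ν l t (n + 1) / a α ν l t (n + 1)

/-- The associated Laguerre polynomial
`L_n^α(x) = ∑_k (-1)^k Γ(n+α+1) / (Γ(k+α+1) (n-k)! k!) x^k`, for `α > -1`. -/
def laguerre (α : ℝ) (n : ℕ) : ℝ[X] :=
  ∑ k ∈ Finset.range (n + 1),
    Polynomial.C ((-1) ^ k * Real.Gamma (n + α + 1) /
      (Real.Gamma (k + α + 1) * ((n - k)! : ℕ) * (k ! : ℕ))) * Polynomial.X ^ k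

/-- The modified Laguerre polynomial: `L_n^α(l x)`, normalized to be orthonormal for the weight
`Γ(ν) x^α e^{-l x}`. -/
def modLaguerre (α ν l : ℝ) (n : ℕ) : ℝ[X] :=
  Polynomial.C (l ^ ((1 + α) / 2) *
      Real.sqrt ((n ! : ℕ) / (Real.Gamma (n + α + 1) * Real.Gamma ν))) *
    (laguerre α n).comp (Polynomial.C l * Polynomial.X)

end

end PrudnikovLaguerre

/-! For a linear functional `L` on polynomials moving with a parameter, the monic orthogonal
polynomial `p_n` moves by a combination of `p_0, …, p_{n-1}`, with coefficients read off from the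
derivative `D` of `L`.

In the parameter `l` the derivative is `D q = -L (X q)`. By orthogonality only `p_{n-1}` survives,
which gives the Toda equation `∂P_n/∂l = (B_n / 2) P_n + A_n P_{n-1}`; as the moments are
continuous up to `l = 0` when `t > 0`, variation of constants gives (i).

In the parameter `t`, the moments `m_s = ∫ x^{s-1} e^{-lx} ρ_ν(xt) dx` satisfy
`t ∂m_s/∂t = l m_{s+1} - s m_s`, so that `t D q = l L (X q) - (α + 1) L q - L (X q')`. The three
terms contribute respectively a multiple of `p_{n-1}`, nothing, and `X p_n' - n p_n`, and
integrating from `0` to `t` gives (ii); at `t = 0` the weight is `Γ(ν) x^α e^{-lx}` and the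
polynomials are those of Laguerre.
-/

namespace PrudnikovLaguerre

noncomputable section

open Polynomial Filter Topology

section Monic

variable {R : Type*} [CommRing R] {p q : R[X]} {n : ℕ}

theorem degree_sub_coeff_smul_lt (hp : p.Monic) (hpn : p.natDegree = n)
    (hq : q.degree < (n + 1 : ℕ)) : (q - q.coeff n • p).degree < n := by
  refine (degree_lt_iff_coeff_zero _ _).2 fun j hj => ?_
  rcases hj.eq_or_lt with rfl | hj
  · simp [← hpn, hp.coeff_natDegree]
  · simp [coeff_eq_zero_of_natDegree_lt (hpn.trans_lt hj), (degree_lt_iff_coeff_zero _ _).1 hq j hj]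

theorem degree_sub_lt_of_monic (hp : p.Monic) (hpn : p.natDegree = n) (hq : q.Monic)
    (hqn : q.natDegree = n) : (q - p).degree < n := by
  have hlt : q.degree < (n + 1 : ℕ) :=
    degree_le_natDegree.trans_lt (by rw [hqn]; exact_mod_cast n.lt_succ_self)
  have hcoeff : q.coeff n = 1 := hqn ▸ hq.coeff_natDegree
  simpa only [hcoeff, one_smul] using degree_sub_coeff_smul_lt hp hpn hlt

end Monic

section MonicOrthogonal

variable {K : Type*} [Field K] (L : K[X] →ₗ[K] K)

/-- The monic orthogonal polynomials of a linear functional `L` on polynomials: Gram-Schmidt for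
the bilinear form `L (p * q)`, applied to `1, X, X², …`. -/
def monicOrthogonal (n : ℕ) : K[X] :=
  X ^ n - ∑ k : Fin n,
    C (L (X ^ n * monicOrthogonal k) / L (monicOrthogonal k ^ 2)) * monicOrthogonal k
termination_by n
decreasing_by all_goals exact k.isLt

/-- The square `L (p_n ^ 2)` of the norm of the `n`-th monic orthogonal polynomial of `L`. -/
def sqNorm (n : ℕ) : K := L (monicOrthogonal L n ^ 2)

theorem monicOrthogonal_eq (n : ℕ) :
    monicOrthogonal L n = X ^ n - ∑ k ∈ Finset.range n,
      (L (X ^ n * monicOrthogonal L k) / sqNorm L k) • monicOrthogonal L k := by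
  simp only [sqNorm, smul_eq_C_mul]
  rw [monicOrthogonal, Finset.sum_range]

theorem degree_monicOrthogonal (n : ℕ) : (monicOrthogonal L n).degree = n := by
  induction n using Nat.strong_induction_on with
  | _ n ih =>
    have hlower : ∑ k ∈ Finset.range n,
        (L (X ^ n * monicOrthogonal L k) / sqNorm L k) • monicOrthogonal L k ∈ degreeLT K n :=
      sum_mem fun k hk => Submodule.smul_mem _ _ <| mem_degreeLT.2 <| by
        rw [ih k (Finset.mem_range.1 hk)]
        exact_mod_cast Finset.mem_range.1 hk
    rw [monicOrthogonal_eq, degree_sub_eq_left_of_degree_lt, degree_X_pow]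
    rw [degree_X_pow]
    exact mem_degreeLT.1 hlower

theorem natDegree_monicOrthogonal (n : ℕ) : (monicOrthogonal L n).natDegree = n :=
  natDegree_eq_of_degree_eq_some (degree_monicOrthogonal L n)

theorem degree_monicOrthogonal_lt {k n : ℕ} (hk : k < n) : (monicOrthogonal L k).degree < n := by
  rw [degree_monicOrthogonal]
  exact_mod_cast hk

theorem monic_monicOrthogonal (n : ℕ) : (monicOrthogonal L n).Monic := by
  have hlower : ∑ k ∈ Finset.range n,
      (L (X ^ n * monicOrthogonal L k) / sqNorm L k) • monicOrthogonal L k ∈ degreeLT K n :=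
    sum_mem fun k hk => Submodule.smul_mem _ _ <| mem_degreeLT.2 <|
      degree_monicOrthogonal_lt L (Finset.mem_range.1 hk)
  rw [monicOrthogonal_eq]
  exact monic_X_pow_sub (mem_degreeLT.1 hlower)

/-- A linear functional on polynomials is quasi-definite when Gram-Schmidt never divides by zero,
that is, when none of its monic orthogonal polynomials is isotropic. -/
def IsQuasiDefinite : Prop := ∀ n, sqNorm L n ≠ 0

variable {L}

namespace IsQuasiDefinite

theorem apply_mul_of_lt (hL : IsQuasiDefinite L) {n k : ℕ} (hk : k < n) :
    L (monicOrthogonal L n * monicOrthogonal L k) = 0 := by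
  induction n using Nat.strong_induction_on generalizing k with
  | _ n ih =>
    have hsum : ∑ j ∈ Finset.range n, L ((L (X ^ n * monicOrthogonal L j) / sqNorm L j) •
        monicOrthogonal L j * monicOrthogonal L k) = L (X ^ n * monicOrthogonal L k) := by
      rw [Finset.sum_eq_single_of_mem k (Finset.mem_range.2 hk)]
      · rw [smul_mul_assoc, map_smul, ← sq, ← sqNorm, smul_eq_mul, div_mul_cancel₀ _ (hL k)]
      · intro j hj hjk
        rw [smul_mul_assoc, map_smul]
        rcases lt_or_gt_of_ne hjk with h | h
        · rw [mul_comm (monicOrthogonal L j), ih k hk h, smul_zero]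
        · rw [ih j (Finset.mem_range.1 hj) h, smul_zero]
    rw [monicOrthogonal_eq L n, sub_mul, map_sub, Finset.sum_mul, map_sum, hsum, sub_self]

theorem apply_mul_of_ne (hL : IsQuasiDefinite L) {n k : ℕ} (hk : n ≠ k) :
    L (monicOrthogonal L n * monicOrthogonal L k) = 0 := by
  rcases lt_or_gt_of_ne hk with h | h
  · rw [mul_comm, hL.apply_mul_of_lt h]
  · exact hL.apply_mul_of_lt h

theorem eq_sum_of_degree_lt (hL : IsQuasiDefinite L) {q : K[X]} {n : ℕ} (hq : q.degree < n) :
    q = ∑ k ∈ Finset.range n, (L (q * monicOrthogonal L k) / sqNorm L k) •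
      monicOrthogonal L k := by
  induction n generalizing q with
  | zero => simpa [Nat.WithBot.lt_zero_iff] using hq
  | succ n ih =>
    set p := monicOrthogonal L
    set r := q - q.coeff n • p n with hr
    have hqr : q = r + q.coeff n • p n := (sub_add_cancel _ _).symm
    have hexp : r = _ := ih (degree_sub_coeff_smul_lt (monic_monicOrthogonal L n)
      (natDegree_monicOrthogonal L n) hq)
    have hr_n : L (r * p n) = 0 := by
      rw [hexp, Finset.sum_mul, map_sum]
      refine Finset.sum_eq_zero fun k hk => ?_
      rw [smul_mul_assoc, map_smul, hL.apply_mul_of_ne (Finset.mem_range.1 hk).ne, smul_zero]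
    have hq_n : L (q * p n) = q.coeff n * sqNorm L n := by
      rw [hqr, add_mul, map_add, hr_n, zero_add, smul_mul_assoc, map_smul, ← sq, ← sqNorm,
        ← hqr, smul_eq_mul]
    have hq_k : ∀ k ∈ Finset.range n, L (q * p k) = L (r * p k) := fun k hk => by
      rw [hr, sub_mul, map_sub, smul_mul_assoc, map_smul,
        hL.apply_mul_of_lt (Finset.mem_range.1 hk), smul_zero, sub_zero]
    rw [Finset.sum_range_succ, Finset.sum_congr rfl fun k hk => by rw [hq_k k hk], ← hexp, hq_n,
      mul_div_cancel_right₀ _ (hL n), ← hqr]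

theorem apply_mul_of_degree_lt (hL : IsQuasiDefinite L) {n : ℕ} {q : K[X]} (hq : q.degree < n) :
    L (monicOrthogonal L n * q) = 0 := by
  rw [hL.eq_sum_of_degree_lt hq, Finset.mul_sum, map_sum]
  refine Finset.sum_eq_zero fun k hk => ?_
  rw [mul_smul_comm, map_smul, hL.apply_mul_of_lt (Finset.mem_range.1 hk), smul_zero]

theorem apply_mul_of_monic (hL : IsQuasiDefinite L) {n : ℕ} {q : K[X]} (hq : q.Monic)
    (hqn : q.natDegree = n) : L (monicOrthogonal L n * q) = sqNorm L n := by
  have h := hL.apply_mul_of_degree_lt (degree_sub_lt_of_monic (monic_monicOrthogonal L n)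
    (natDegree_monicOrthogonal L n) hq hqn)
  rw [mul_sub, map_sub, ← sq] at h
  exact sub_eq_zero.1 h

theorem eq_monicOrthogonal (hL : IsQuasiDefinite L) {n : ℕ} {q : K[X]} (hq : q.Monic)
    (hqn : q.natDegree = n) (h : ∀ k < n, L (q * X ^ k) = 0) : q = monicOrthogonal L n := by
  have horth : ∀ k < n, L (q * monicOrthogonal L k) = 0 := fun k hk => by
    rw [as_sum_range_C_mul_X_pow (monicOrthogonal L k), Finset.mul_sum, map_sum]
    refine Finset.sum_eq_zero fun j hj => ?_
    rw [natDegree_monicOrthogonal, Finset.mem_range_succ_iff] at hj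
    rw [mul_left_comm, ← smul_eq_C_mul, map_smul, h j (hj.trans_lt hk), smul_zero]
  rw [← sub_eq_zero, hL.eq_sum_of_degree_lt (degree_sub_lt_of_monic (monic_monicOrthogonal L n)
    (natDegree_monicOrthogonal L n) hq hqn)]
  refine Finset.sum_eq_zero fun k hk => ?_
  rw [Finset.mem_range] at hk
  rw [sub_mul, map_sub, horth k hk, hL.apply_mul_of_lt hk, sub_zero, zero_div, zero_smul]

theorem apply_X_mul_succ_mul (hL : IsQuasiDefinite L) (n : ℕ) :
    L (X * (monicOrthogonal L (n + 1) * monicOrthogonal L n)) = sqNorm L (n + 1) := by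
  rw [mul_left_comm]
  refine hL.apply_mul_of_monic (monic_X.mul (monic_monicOrthogonal L n)) ?_
  rw [natDegree_X_mul (monic_monicOrthogonal L n).ne_zero, natDegree_monicOrthogonal]

theorem apply_X_mul_succ_mul_of_lt (hL : IsQuasiDefinite L) {n k : ℕ} (hk : k < n) :
    L (X * (monicOrthogonal L (n + 1) * monicOrthogonal L k)) = 0 := by
  rw [mul_left_comm]
  refine hL.apply_mul_of_degree_lt ?_
  rw [X_mul, degree_mul_X, degree_monicOrthogonal]
  exact_mod_cast Nat.succ_lt_succ hk

end IsQuasiDefinite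

end MonicOrthogonal

section DiagCoeff

variable {K : Type*} [Field K] (L : K[X] →ₗ[K] K)

/-- The diagonal coefficient `β_n` of the three-term recurrence
`X p_n = p_{n+1} + β_n p_n + γ_n p_{n-1}` of the monic orthogonal polynomials of `L`, read off
the coefficients of `X ^ n`. -/
def diagCoeff (n : ℕ) : K :=
  (monicOrthogonal L n).nextCoeff - (monicOrthogonal L (n + 1)).nextCoeff

theorem degree_X_mul_sub_lt (n : ℕ) :
    (X * monicOrthogonal L n - monicOrthogonal L (n + 1) -
      diagCoeff L n • monicOrthogonal L n).degree < (n : WithBot ℕ) := by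
  have hX : (X * monicOrthogonal L n).natDegree = n + 1 := by
    rw [natDegree_X_mul (monic_monicOrthogonal L n).ne_zero, natDegree_monicOrthogonal]
  have hX0 : (X : K[X]).nextCoeff = 0 := by simp [nextCoeff]
  have hcoeff : (X * monicOrthogonal L n - monicOrthogonal L (n + 1)).coeff n = diagCoeff L n := by
    have h1 := nextCoeff_of_natDegree_pos (p := X * monicOrthogonal L n) (by lia)
    have h2 := nextCoeff_of_natDegree_pos (p := monicOrthogonal L (n + 1))
      (by rw [natDegree_monicOrthogonal]; lia)
    rw [hX, monic_X.nextCoeff_mul (monic_monicOrthogonal L n), hX0, zero_add,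
      Nat.add_sub_cancel] at h1
    rw [natDegree_monicOrthogonal, Nat.add_sub_cancel] at h2
    rw [diagCoeff, h1, h2, coeff_sub]
  rw [← hcoeff]
  exact degree_sub_coeff_smul_lt (monic_monicOrthogonal L n) (natDegree_monicOrthogonal L n)
    (degree_sub_lt_of_monic (monic_monicOrthogonal L (n + 1)) (natDegree_monicOrthogonal L _)
      (monic_X.mul (monic_monicOrthogonal L n)) hX)

variable {L}

theorem IsQuasiDefinite.apply_X_mul_sq (hL : IsQuasiDefinite L) (n : ℕ) :
    L (X * monicOrthogonal L n ^ 2) = diagCoeff L n * sqNorm L n := by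
  have h := hL.apply_mul_of_degree_lt (degree_X_mul_sub_lt L n)
  rw [mul_sub, mul_sub, map_sub, map_sub, hL.apply_mul_of_ne n.lt_succ_self.ne, mul_smul_comm,
    map_smul, ← sq, mul_left_comm, ← sq, smul_eq_mul, sub_zero] at h
  exact sub_eq_zero.1 h

end DiagCoeff

section Positive

variable {K : Type*} [Field K] [LinearOrder K] {L : K[X] →ₗ[K] K}

/-- A linear functional on polynomials is positive when it is positive on nonzero squares. -/
def IsPositive (L : K[X] →ₗ[K] K) : Prop := ∀ q : K[X], q ≠ 0 → 0 < L (q ^ 2)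

theorem IsPositive.sqNorm_pos (hL : IsPositive L) (n : ℕ) : 0 < sqNorm L n :=
  hL _ (monic_monicOrthogonal L n).ne_zero

theorem IsPositive.isQuasiDefinite (hL : IsPositive L) : IsQuasiDefinite L :=
  fun n => (hL.sqNorm_pos n).ne'

end Positive

section FirstVariation

variable {K : Type*} [Field K] (L : K[X] →ₗ[K] K)

/-- The first variation of the `n`-th monic orthogonal polynomial of `L`, as a function of the
direction `D` in which `L` is varied. -/
def firstVariation (n : ℕ) : (K[X] →ₗ[K] K) →ₗ[K] K[X] where
  toFun D := -∑ k ∈ Finset.range n,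
    (D (monicOrthogonal L n * monicOrthogonal L k) / sqNorm L k) • monicOrthogonal L k
  map_add' D E := by
    simp only [LinearMap.add_apply, add_div, add_smul, Finset.sum_add_distrib, neg_add]
  map_smul' c D := by
    simp only [LinearMap.smul_apply, smul_eq_mul, mul_div_assoc, mul_smul, smul_neg,
      Finset.smul_sum, RingHom.id_apply]

theorem firstVariation_apply (n : ℕ) (D : K[X] →ₗ[K] K) :
    firstVariation L n D = -∑ k ∈ Finset.range n,
      (D (monicOrthogonal L n * monicOrthogonal L k) / sqNorm L k) • monicOrthogonal L k :=
  rfl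

/-- Multiplication by `X`, as an operator on polynomials. -/
def mulX : K[X] →ₗ[K] K[X] := LinearMap.mulLeft K X

/-- The Euler operator `X d/dX` on polynomials. -/
def euler : K[X] →ₗ[K] K[X] := LinearMap.mulLeft K X ∘ₗ Polynomial.derivative

theorem mulX_apply (q : K[X]) : mulX q = X * q := rfl

theorem euler_apply (q : K[X]) : euler q = X * derivative q := rfl

variable {L} (hL : IsQuasiDefinite L)
include hL

theorem IsQuasiDefinite.firstVariation_self (n : ℕ) : firstVariation L n L = 0 := by
  rw [firstVariation_apply, neg_eq_zero]
  refine Finset.sum_eq_zero fun k hk => ?_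
  rw [hL.apply_mul_of_lt (Finset.mem_range.1 hk), zero_div, zero_smul]

theorem IsQuasiDefinite.firstVariation_comp_mulX (n : ℕ) :
    firstVariation L (n + 1) (L ∘ₗ mulX) =
      -((sqNorm L (n + 1) / sqNorm L n) • monicOrthogonal L n) := by
  simp only [firstVariation_apply, LinearMap.comp_apply, mulX_apply]
  rw [Finset.sum_range_succ, Finset.sum_eq_zero, zero_add, hL.apply_X_mul_succ_mul]
  intro k hk
  rw [hL.apply_X_mul_succ_mul_of_lt (Finset.mem_range.1 hk), zero_div, zero_smul]

theorem IsQuasiDefinite.firstVariation_comp_euler (n : ℕ) :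
    firstVariation L n (L ∘ₗ euler) =
      -(X * derivative (monicOrthogonal L n) - (n : K) • monicOrthogonal L n) := by
  set p := monicOrthogonal L
  have hdeg : (X * derivative (p n) - (n : K) • p n).degree < (n : WithBot ℕ) := by
    refine (degree_lt_iff_coeff_zero _ _).2 fun j hj => ?_
    obtain rfl | hj' := hj.eq_or_lt
    · cases n <;> simp [coeff_derivative, mul_comm]
    · obtain ⟨j, rfl⟩ := Nat.exists_eq_add_of_lt hj'
      have h0 : (p n).coeff (n + j + 1) = 0 :=
        coeff_eq_zero_of_natDegree_lt (by rw [natDegree_monicOrthogonal]; lia)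
      simp [coeff_derivative, h0]
  rw [firstVariation_apply, neg_inj, hL.eq_sum_of_degree_lt hdeg]
  refine Finset.sum_congr rfl fun k hk => ?_
  rw [Finset.mem_range] at hk
  have hk' : L (p n * (X * derivative (p k))) = 0 := by
    refine hL.apply_mul_of_degree_lt ((degree_lt_iff_coeff_zero _ _).2 fun j hj => ?_)
    obtain ⟨j, rfl⟩ : ∃ i, j = i + 1 := ⟨j - 1, by lia⟩
    rw [coeff_X_mul, coeff_derivative, coeff_eq_zero_of_natDegree_lt, zero_mul]
    rw [natDegree_monicOrthogonal]
    lia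
  have hsplit : euler (p n * p k) = X * derivative (p n) * p k + p n * (X * derivative (p k)) := by
    rw [euler_apply, derivative_mul]
    ring
  rw [LinearMap.comp_apply, hsplit, map_add, hk', add_zero, sub_mul, map_sub, smul_mul_assoc,
    map_smul, hL.apply_mul_of_lt hk, smul_zero, sub_zero]

end FirstVariation

theorem map_eq_sum_range {R : Type*} [CommRing R] (L : R[X] →ₗ[R] R) {q : R[X]} {N : ℕ}
    (h : q.natDegree ≤ N) :
    L q = ∑ k ∈ Finset.range (N + 1), q.coeff k * L (X ^ k) := by
  conv_lhs => rw [as_sum_range_C_mul_X_pow' q (Nat.lt_succ_of_le h), map_sum]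
  simp only [← smul_eq_C_mul, map_smul, smul_eq_mul]

section CoeffTendsto

variable {ι R : Type*} [CommRing R] [TopologicalSpace R]

/-- Coefficientwise convergence of a family of polynomials of bounded degree. -/
structure CoeffTendsto (p : ι → R[X]) (l : Filter ι) (q : R[X]) : Prop where
  exists_natDegree_le : ∃ N, q.natDegree ≤ N ∧ ∀ i, (p i).natDegree ≤ N
  tendsto_coeff : ∀ k, Tendsto (fun i => (p i).coeff k) l (𝓝 (q.coeff k))

namespace CoeffTendsto

variable {p p' : ι → R[X]} {l : Filter ι} {q q' : R[X]}

theorem const (q : R[X]) : CoeffTendsto (fun _ : ι => q) l q :=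
  ⟨⟨_, le_rfl, fun _ => le_rfl⟩, fun _ => tendsto_const_nhds⟩

theorem mono (h : CoeffTendsto p l q) {l' : Filter ι} (hl : l' ≤ l) : CoeffTendsto p l' q :=
  ⟨h.exists_natDegree_le, fun k => (h.tendsto_coeff k).mono_left hl⟩

variable [IsTopologicalRing R]

theorem mul (h : CoeffTendsto p l q) (h' : CoeffTendsto p' l q') :
    CoeffTendsto (fun i => p i * p' i) l (q * q') := by
  obtain ⟨N, hqN, hpN⟩ := h.exists_natDegree_le
  obtain ⟨N', hqN', hpN'⟩ := h'.exists_natDegree_le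
  refine ⟨⟨N + N', natDegree_mul_le_of_le hqN hqN',
    fun i => natDegree_mul_le_of_le (hpN i) (hpN' i)⟩, fun k => ?_⟩
  simp only [coeff_mul]
  exact tendsto_finsetSum _ fun i _ => (h.tendsto_coeff _).mul (h'.tendsto_coeff _)

theorem apply {L : ι → R[X] →ₗ[R] R} {L₀ : R[X] →ₗ[R] R} (h : CoeffTendsto p l q)
    (hL : ∀ k, Tendsto (fun i => L i (X ^ k)) l (𝓝 (L₀ (X ^ k)))) :
    Tendsto (fun i => L i (p i)) l (𝓝 (L₀ q)) := by
  obtain ⟨N, hqN, hpN⟩ := h.exists_natDegree_le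
  simp only [fun i => map_eq_sum_range (L i) (hpN i), map_eq_sum_range L₀ hqN]
  exact tendsto_finsetSum _ fun k _ => (h.tendsto_coeff k).mul (hL k)

theorem eval (h : CoeffTendsto p l q) (x : R) :
    Tendsto (fun i => (p i).eval x) l (𝓝 (q.eval x)) :=
  h.apply (L := fun _ => leval x) (L₀ := leval x) fun _ => tendsto_const_nhds

end CoeffTendsto

theorem CoeffTendsto.monicOrthogonal {K : Type*} [Field K] [TopologicalSpace K]
    [IsTopologicalDivisionRing K] {l : Filter ι} {L : ι → K[X] →ₗ[K] K} {L₀ : K[X] →ₗ[K] K}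
    (hL : ∀ k, Tendsto (fun i => L i (X ^ k)) l (𝓝 (L₀ (X ^ k)))) (hL₀ : IsQuasiDefinite L₀)
    (n : ℕ) : CoeffTendsto (fun i => monicOrthogonal (L i) n) l (monicOrthogonal L₀ n) := by
  induction n using Nat.strong_induction_on with
  | _ n ih =>
    refine ⟨⟨n, (natDegree_monicOrthogonal _ n).le, fun i => (natDegree_monicOrthogonal _ n).le⟩,
      fun j => ?_⟩
    simp only [monicOrthogonal_eq _ n, coeff_sub, finsetSum_coeff, coeff_smul]
    refine tendsto_const_nhds.sub (tendsto_finsetSum _ fun k hk => ?_)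
    have hk := ih k (Finset.mem_range.1 hk)
    refine ((((const (X ^ n)).mul hk).apply hL).div ?_ (hL₀ k)).smul (hk.tendsto_coeff j)
    simp only [sqNorm, sq]
    exact (hk.mul hk).apply hL

end CoeffTendsto

section Perturbation

variable {K : Type*} [Field K] {L M : K[X] →ₗ[K] K}

theorem IsQuasiDefinite.monicOrthogonal_sub (hL : IsQuasiDefinite L) (hM : IsQuasiDefinite M)
    (n : ℕ) : monicOrthogonal M n - monicOrthogonal L n = -∑ k ∈ Finset.range n,
      ((M - L) (monicOrthogonal M n * monicOrthogonal L k) / sqNorm L k) •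
        monicOrthogonal L k := by
  rw [hL.eq_sum_of_degree_lt (degree_sub_lt_of_monic (monic_monicOrthogonal L n)
    (natDegree_monicOrthogonal L n) (monic_monicOrthogonal M n) (natDegree_monicOrthogonal M n)),
    ← Finset.sum_neg_distrib]
  refine Finset.sum_congr rfl fun k hk => ?_
  rw [Finset.mem_range] at hk
  rw [sub_mul, map_sub, hL.apply_mul_of_lt hk, LinearMap.sub_apply,
    hM.apply_mul_of_degree_lt (degree_monicOrthogonal_lt L hk), sub_zero, zero_sub, neg_div,
    neg_smul, neg_neg]

theorem IsQuasiDefinite.sqNorm_sub (hL : IsQuasiDefinite L) (hM : IsQuasiDefinite M) (n : ℕ) :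
    sqNorm M n - sqNorm L n = (M - L) (monicOrthogonal M n * monicOrthogonal L n) := by
  rw [LinearMap.sub_apply, hM.apply_mul_of_monic (monic_monicOrthogonal L n)
    (natDegree_monicOrthogonal L n), mul_comm, hL.apply_mul_of_monic (monic_monicOrthogonal M n)
    (natDegree_monicOrthogonal M n)]

end Perturbation

section HasDerivAt

variable {𝕜 : Type*} [NontriviallyNormedField 𝕜] {L : 𝕜 → 𝕜[X] →ₗ[𝕜] 𝕜} {D : 𝕜[X] →ₗ[𝕜] 𝕜}
  {s₀ : 𝕜} (hD : ∀ k, HasDerivAt (fun s => L s (X ^ k)) (D (X ^ k)) s₀)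
include hD

theorem hasDerivAt_sub_apply {q : 𝕜 → 𝕜[X]} (hq : CoeffTendsto q (𝓝 s₀) (q s₀)) :
    HasDerivAt (fun s => (L s - L s₀) (q s)) (D (q s₀)) s₀ := by
  rw [hasDerivAt_iff_tendsto_slope]
  refine ((hq.mono nhdsWithin_le_nhds).apply (L := fun s => (s - s₀)⁻¹ • (L s - L s₀))
    fun k => ?_).congr fun s => ?_
  · simpa [slope_fun_def] using (hD k).tendsto_slope
  · simp [slope]

variable (hL : ∀ᶠ s in 𝓝 s₀, IsQuasiDefinite (L s))
include hL

theorem hasDerivAt_eval_monicOrthogonal (n : ℕ) (x : 𝕜) :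
    HasDerivAt (fun s => (monicOrthogonal (L s) n).eval x)
      ((firstVariation (L s₀) n D).eval x) s₀ := by
  have h₀ := hL.self_of_nhds
  have hp := CoeffTendsto.monicOrthogonal (fun k => (hD k).continuousAt) h₀ n
  have hsum : HasDerivAt (fun s => (monicOrthogonal (L s₀) n).eval x + -∑ k ∈ Finset.range n,
      ((L s - L s₀) (monicOrthogonal (L s) n * monicOrthogonal (L s₀) k) / sqNorm (L s₀) k) *
        (monicOrthogonal (L s₀) k).eval x) ((firstVariation (L s₀) n D).eval x) s₀ := by
    simp only [firstVariation_apply, eval_neg, eval_finsetSum, eval_smul, smul_eq_mul]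
    exact (HasDerivAt.fun_sum fun k _ => ((hasDerivAt_sub_apply hD
      (hp.mul (.const _))).div_const _).mul_const _).fun_neg.const_add _
  refine hsum.congr_of_eventuallyEq (hL.mono fun s hs => ?_)
  rw [← sub_eq_iff_eq_add', ← eval_sub, h₀.monicOrthogonal_sub hs]
  simp only [eval_neg, eval_finsetSum, eval_smul, smul_eq_mul]

theorem hasDerivAt_sqNorm (n : ℕ) :
    HasDerivAt (fun s => sqNorm (L s) n) (D (monicOrthogonal (L s₀) n ^ 2)) s₀ := by
  have h₀ := hL.self_of_nhds
  have hp := CoeffTendsto.monicOrthogonal (fun k => (hD k).continuousAt) h₀ n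
  rw [sq]
  refine ((hasDerivAt_sub_apply hD (hp.mul (.const _))).const_add
    (sqNorm (L s₀) n)).congr_of_eventuallyEq (hL.mono fun s hs => ?_)
  rw [← sub_eq_iff_eq_add', h₀.sqNorm_sub hs]

end HasDerivAt

section ContinuousOn

variable {K : Type*} [Field K] [TopologicalSpace K] [IsTopologicalDivisionRing K]
  {T : Type*} [TopologicalSpace T] {S : Set T} {L : T → K[X] →ₗ[K] K}
  (hL : ∀ k, ContinuousOn (fun s => L s (X ^ k)) S) (hS : ∀ s ∈ S, IsQuasiDefinite (L s))
include hL hS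

theorem coeffTendsto_monicOrthogonal (n : ℕ) {s : T} (hs : s ∈ S) :
    CoeffTendsto (fun s => monicOrthogonal (L s) n) (𝓝[S] s) (monicOrthogonal (L s) n) :=
  .monicOrthogonal (fun k => hL k s hs) (hS s hs) n

theorem continuousOn_eval_monicOrthogonal (n : ℕ) (x : K) :
    ContinuousOn (fun s => (monicOrthogonal (L s) n).eval x) S :=
  fun _ hs => (coeffTendsto_monicOrthogonal hL hS n hs).eval x

theorem continuousOn_sqNorm (n : ℕ) : ContinuousOn (fun s => sqNorm (L s) n) S := fun s hs => by
  have hp := coeffTendsto_monicOrthogonal hL hS n hs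
  simp only [ContinuousWithinAt, sqNorm, sq]
  exact (hp.mul hp).apply fun k => hL k s hs

theorem continuousOn_diagCoeff (n : ℕ) : ContinuousOn (fun s => diagCoeff (L s) n) S := by
  have hnext : ∀ n, ContinuousOn (fun s => (monicOrthogonal (L s) n).nextCoeff) S
  | 0 => by
    simpa only [nextCoeff, natDegree_monicOrthogonal, if_true] using continuousOn_const
  | n + 1 => fun s hs => by
    simpa only [nextCoeff, natDegree_monicOrthogonal, n.succ_ne_zero, if_false] using!
      (coeffTendsto_monicOrthogonal hL hS (n + 1) hs).tendsto_coeff n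
  exact (hnext n).sub (hnext (n + 1))

end ContinuousOn

theorem intervalIntegrable_eval_firstVariation {L D : ℝ → ℝ[X] →ₗ[ℝ] ℝ} {a b : ℝ}
    (hL : ∀ k, ContinuousOn (fun s => L s (X ^ k)) (Set.uIcc a b))
    (hab : ∀ s ∈ Set.uIcc a b, IsQuasiDefinite (L s))
    (hD : ∀ k, IntervalIntegrable (fun s => D s (X ^ k)) volume a b) (n : ℕ) (x : ℝ) :
    IntervalIntegrable (fun s => (firstVariation (L s) n (D s)).eval x) volume a b := by
  have hdeg : ∀ k s, (monicOrthogonal (L s) n * monicOrthogonal (L s) k).natDegree ≤ n + k :=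
    fun k s => natDegree_mul_le_of_le (natDegree_monicOrthogonal _ n).le
      (natDegree_monicOrthogonal _ k).le
  have happly : ∀ k, IntervalIntegrable
      (fun s => D s (monicOrthogonal (L s) n * monicOrthogonal (L s) k)) volume a b := fun k => by
    simpa only [fun s => map_eq_sum_range (D s) (hdeg k s), Finset.sum_fn] using
      IntervalIntegrable.sum _ fun j _ => (hD j).continuousOn_mul fun s hs =>
        ((coeffTendsto_monicOrthogonal hL hab n hs).mul
          (coeffTendsto_monicOrthogonal hL hab k hs)).tendsto_coeff j
  have hterm : ∀ k, IntervalIntegrable (fun s =>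
      D s (monicOrthogonal (L s) n * monicOrthogonal (L s) k) / sqNorm (L s) k *
        (monicOrthogonal (L s) k).eval x) volume a b := fun k => by
    simp only [div_eq_mul_inv]
    exact ((happly k).mul_continuousOn ((continuousOn_sqNorm hL hab k).fun_inv₀
      fun s hs => hab s hs k)).mul_continuousOn (continuousOn_eval_monicOrthogonal hL hab k x)
  simp only [firstVariation_apply, eval_neg, eval_finsetSum, eval_smul, smul_eq_mul]
  have hsum := IntervalIntegrable.sum (Finset.range n) fun k _ => hterm k
  simp only [Finset.sum_fn] at hsum
  exact hsum.neg

section Orthonormal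

variable (L : ℝ[X] →ₗ[ℝ] ℝ)

/-- The leading coefficient of the `n`-th orthonormal polynomial of `L`, taken of sign
`(-1) ^ n`. -/
def leadCoeff (n : ℕ) : ℝ := (-1) ^ n / √(sqNorm L n)

/-- The orthonormal polynomials of `L`, with leading coefficient of sign `(-1) ^ n`. -/
def orthonormalPoly (n : ℕ) : ℝ[X] := C (leadCoeff L n) * monicOrthogonal L n

theorem coeff_orthonormalPoly_self (n : ℕ) : (orthonormalPoly L n).coeff n = leadCoeff L n := by
  have h := (monic_monicOrthogonal L n).coeff_natDegree
  rw [natDegree_monicOrthogonal] at h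
  rw [orthonormalPoly, coeff_C_mul, h, mul_one]

theorem eval_orthonormalPoly (n : ℕ) (x : ℝ) :
    (orthonormalPoly L n).eval x = leadCoeff L n * (monicOrthogonal L n).eval x := by
  rw [orthonormalPoly, eval_mul, eval_C]

namespace IsPositive

variable {L} (hL : IsPositive L)
include hL

theorem neg_one_pow_mul_leadCoeff_pos (n : ℕ) : 0 < (-1) ^ n * leadCoeff L n := by
  have hsign : (-1 : ℝ) ^ n * (-1) ^ n = 1 := by rw [← mul_pow]; norm_num
  rw [leadCoeff, ← mul_div_assoc, hsign]
  exact one_div_pos.2 (Real.sqrt_pos.2 (hL.sqNorm_pos n))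

theorem leadCoeff_ne_zero (n : ℕ) : leadCoeff L n ≠ 0 :=
  right_ne_zero_of_mul (hL.neg_one_pow_mul_leadCoeff_pos n).ne'

theorem leadCoeff_sq (n : ℕ) : leadCoeff L n ^ 2 = (sqNorm L n)⁻¹ := by
  rw [leadCoeff, div_pow, Real.sq_sqrt (hL.sqNorm_pos n).le, ← pow_mul, mul_comm n,
    pow_mul, neg_one_sq, one_pow, one_div]

theorem natDegree_orthonormalPoly (n : ℕ) : (orthonormalPoly L n).natDegree = n := by
  rw [orthonormalPoly, natDegree_C_mul (hL.leadCoeff_ne_zero n), natDegree_monicOrthogonal]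

theorem apply_orthonormalPoly_mul (m k : ℕ) :
    L (orthonormalPoly L m * orthonormalPoly L k) = if m = k then 1 else 0 := by
  rw [orthonormalPoly, orthonormalPoly, mul_mul_mul_comm, ← C_mul, ← smul_eq_C_mul, map_smul,
    smul_eq_mul]
  split_ifs with h
  · rw [h, ← sq, ← sq, ← sqNorm, hL.leadCoeff_sq, inv_mul_cancel₀ (hL.sqNorm_pos k).ne']
  · rw [hL.isQuasiDefinite.apply_mul_of_ne h, mul_zero]

theorem leadCoeff_mul_eval_monicOrthogonal_pred (n : ℕ) (x : ℝ) :
    leadCoeff L (n + 1) * (sqNorm L (n + 1) / sqNorm L n * (monicOrthogonal L n).eval x) =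
      leadCoeff L n / leadCoeff L (n + 1) * (orthonormalPoly L n).eval x := by
  have h := hL.leadCoeff_ne_zero (n + 1)
  rw [eval_orthonormalPoly, ← inv_inv (sqNorm L (n + 1)), ← hL.leadCoeff_sq, div_eq_mul_inv _
    (sqNorm L n), ← hL.leadCoeff_sq]
  field_simp

end IsPositive

section ContinuousOn

variable {T : Type*} [TopologicalSpace T] {S : Set T} {L : T → ℝ[X] →ₗ[ℝ] ℝ}
  (hL : ∀ k, ContinuousOn (fun s => L s (X ^ k)) S) (hS : ∀ s ∈ S, IsPositive (L s))
include hL hS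

theorem continuousOn_leadCoeff (n : ℕ) : ContinuousOn (fun s => leadCoeff (L s) n) S :=
  continuousOn_const.div (continuousOn_sqNorm hL (fun s hs => (hS s hs).isQuasiDefinite) n).sqrt
    fun s hs => (Real.sqrt_pos.2 ((hS s hs).sqNorm_pos n)).ne'

theorem continuousOn_eval_orthonormalPoly (n : ℕ) (x : ℝ) :
    ContinuousOn (fun s => (orthonormalPoly (L s) n).eval x) S := by
  simp only [eval_orthonormalPoly]
  exact (continuousOn_leadCoeff hL hS n).mul
    (continuousOn_eval_monicOrthogonal hL (fun s hs => (hS s hs).isQuasiDefinite) n x)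

end ContinuousOn

section TodaFlow

variable {L : ℝ → ℝ[X] →ₗ[ℝ] ℝ} {s₀ : ℝ}
  (hD : ∀ k, HasDerivAt (fun s => L s (X ^ k)) (-L s₀ (X ^ (k + 1))) s₀)
  (hL : ∀ᶠ s in 𝓝 s₀, IsPositive (L s))
include hD hL

theorem hasDerivAt_leadCoeff_toda (n : ℕ) :
    HasDerivAt (fun s => leadCoeff (L s) n) (diagCoeff (L s₀) n / 2 * leadCoeff (L s₀) n) s₀ := by
  have hpos := hL.self_of_nhds
  have hsq : HasDerivAt (fun s => sqNorm (L s) n)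
      (-(diagCoeff (L s₀) n * sqNorm (L s₀) n)) s₀ := by
    rw [← hpos.isQuasiDefinite.apply_X_mul_sq]
    refine hasDerivAt_sqNorm (D := -(L s₀ ∘ₗ mulX)) (fun k => (hD k).congr_deriv ?_)
      (hL.mono fun s hs => hs.isQuasiDefinite) n
    rw [LinearMap.neg_apply, LinearMap.comp_apply, mulX_apply, pow_succ']
  have hne := (hpos.sqNorm_pos n).ne'
  have hsqrt := (Real.sqrt_pos.2 (hpos.sqNorm_pos n)).ne'
  refine ((hasDerivAt_const s₀ ((-1 : ℝ) ^ n)).fun_div (hsq.sqrt hne) hsqrt).congr_deriv ?_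
  rw [leadCoeff, Real.sq_sqrt (hpos.sqNorm_pos n).le]
  field_simp
  ring

theorem hasDerivAt_eval_orthonormalPoly_toda (n : ℕ) (x : ℝ) :
    HasDerivAt (fun s => (orthonormalPoly (L s) (n + 1)).eval x)
      (diagCoeff (L s₀) (n + 1) / 2 * (orthonormalPoly (L s₀) (n + 1)).eval x +
        leadCoeff (L s₀) n / leadCoeff (L s₀) (n + 1) * (orthonormalPoly (L s₀) n).eval x) s₀ := by
  have hpos := hL.self_of_nhds
  have hmonic : HasDerivAt (fun s => (monicOrthogonal (L s) (n + 1)).eval x)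
      (sqNorm (L s₀) (n + 1) / sqNorm (L s₀) n * (monicOrthogonal (L s₀) n).eval x) s₀ := by
    refine (hasDerivAt_eval_monicOrthogonal (D := -(L s₀ ∘ₗ mulX))
      (fun k => (hD k).congr_deriv ?_) (hL.mono fun s hs => hs.isQuasiDefinite)
      (n + 1) x).congr_deriv ?_
    · rw [LinearMap.neg_apply, LinearMap.comp_apply, mulX_apply, pow_succ']
    · rw [map_neg, hpos.isQuasiDefinite.firstVariation_comp_mulX, neg_neg, eval_smul, smul_eq_mul]
  rw [← hpos.leadCoeff_mul_eval_monicOrthogonal_pred]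
  simp only [eval_orthonormalPoly]
  exact ((hasDerivAt_leadCoeff_toda hD hL (n + 1)).fun_mul hmonic).congr_deriv (by ring)

end TodaFlow

end Orthonormal

section VariationOfConstants

variable {E : Type*} [NormedAddCommGroup E] [NormedSpace ℝ E] {f g : ℝ → E} {b : ℝ → ℝ} {u v : ℝ}

theorem continuousOn_exp_integral_left (hb : ContinuousOn b (Set.uIcc u v)) :
    ContinuousOn (fun ξ => Real.exp (∫ y in ξ..v, b y)) (Set.uIcc u v) :=
  (intervalIntegral.continuousOn_primitive_interval_left
    (hb.integrableOn_compact isCompact_uIcc)).rexp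

theorem eq_integral_exp_smul_add_of_hasDerivAt [CompleteSpace E] (huv : u ≤ v)
    (hf : ContinuousOn f (Set.Icc u v)) (hb : ContinuousOn b (Set.Icc u v))
    (hg : ContinuousOn g (Set.Icc u v))
    (hf' : ∀ ξ ∈ Set.Ioo u v, HasDerivAt f (b ξ • f ξ + g ξ) ξ) :
    f v = (∫ ξ in u..v, Real.exp (∫ y in ξ..v, b y) • g ξ) +
      Real.exp (∫ y in u..v, b y) • f u := by
  have hbi : IntervalIntegrable b volume u v := hb.intervalIntegrable_of_Icc huv
  have hexp : ContinuousOn (fun ξ => Real.exp (∫ y in ξ..v, b y)) (Set.Icc u v) := by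
    rw [← Set.uIcc_of_le huv] at hb ⊢
    exact continuousOn_exp_integral_left hb
  have hderiv : ∀ ξ ∈ Set.Ioo u v, HasDerivAt (fun ξ => Real.exp (∫ y in ξ..v, b y) • f ξ)
      (Real.exp (∫ y in ξ..v, b y) • g ξ) ξ := fun ξ hξ => by
    have hprim : HasDerivAt (fun ξ => ∫ y in ξ..v, b y) (-b ξ) ξ :=
      intervalIntegral.integral_hasDerivAt_left
        (hbi.mono_set (Set.uIcc_subset_uIcc_right
          (Set.Icc_subset_uIcc (Set.Ioo_subset_Icc_self hξ))))
        ((hb.mono Set.Ioo_subset_Icc_self).stronglyMeasurableAtFilter isOpen_Ioo ξ hξ)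
        (hb.continuousAt (Icc_mem_nhds hξ.1 hξ.2))
    exact (hprim.exp.smul (hf' ξ hξ)).congr_deriv (by module)
  rw [intervalIntegral.integral_eq_sub_of_hasDerivAt_of_le huv (hexp.smul hf) hderiv
    ((hexp.smul hg).intervalIntegrable_of_Icc huv)]
  simp

end VariationOfConstants

section Macdonald

theorem integrableOn_rpow_mul_exp_neg_mul {s b : ℝ} (hs : -1 < s) (hb : 0 < b) :
    IntegrableOn (fun x : ℝ => x ^ s * Real.exp (-b * x)) (Set.Ioi 0) := by
  simpa only [Real.rpow_one] using integrableOn_rpow_mul_exp_neg_mul_rpow hs one_pos hb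

theorem integrableOn_rpow_mul_exp_neg {s : ℝ} (hs : -1 < s) :
    IntegrableOn (fun x : ℝ => x ^ s * Real.exp (-x)) (Set.Ioi 0) := by
  simpa only [neg_one_mul] using integrableOn_rpow_mul_exp_neg_mul hs one_pos

theorem integrableOn_rpow_mul_exp_neg_sub_div {ν x : ℝ} (hν : 0 < ν) (hx : 0 ≤ x) :
    IntegrableOn (fun u : ℝ => u ^ (ν - 1) * Real.exp (-u - x / u)) (Set.Ioi 0) := by
  refine Integrable.mono' (integrableOn_rpow_mul_exp_neg (s := ν - 1) (by linarith))
    (by fun_prop) ?_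
  filter_upwards [self_mem_ae_restrict measurableSet_Ioi] with u (hu : 0 < u)
  rw [Real.norm_of_nonneg (by positivity)]
  gcongr
  exact sub_le_self _ (by positivity)

section ExpSubstitution

theorem hasDerivWithinAt_mul_exp (c s : ℝ) (S : Set ℝ) :
    HasDerivWithinAt (fun s => c * Real.exp s) (c * Real.exp s) S s :=
  ((Real.hasDerivAt_exp s).const_mul c).hasDerivWithinAt

variable {c : ℝ} (hc : 0 < c)
include hc

theorem image_mul_exp_univ : (fun s => c * Real.exp s) '' Set.univ = Set.Ioi 0 := by
  rw [Set.image_univ, show (fun s => c * Real.exp s) = (c * ·) ∘ Real.exp from rfl, Set.range_comp,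
    Real.range_exp, Set.image_mul_left_Ioi hc, mul_zero]

theorem injOn_mul_exp : Set.InjOn (fun s => c * Real.exp s) Set.univ := fun _ _ _ _ h =>
  Real.exp_injective (mul_left_cancel₀ hc.ne' h)

theorem integral_Ioi_eq_integral_mul_exp (f : ℝ → ℝ) :
    ∫ u in Set.Ioi 0, f u = ∫ s, c * Real.exp s * f (c * Real.exp s) := by
  rw [← image_mul_exp_univ hc, integral_image_eq_integral_abs_deriv_smul MeasurableSet.univ
    (fun s _ => hasDerivWithinAt_mul_exp c s _) (injOn_mul_exp hc), Measure.restrict_univ]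
  simp only [abs_of_pos (mul_pos hc (Real.exp_pos _)), smul_eq_mul]

theorem integrable_mul_exp_of_integrableOn_Ioi {f : ℝ → ℝ} (hf : IntegrableOn f (Set.Ioi 0)) :
    Integrable fun s => c * Real.exp s * f (c * Real.exp s) := by
  rw [← image_mul_exp_univ hc, integrableOn_image_iff_integrableOn_abs_deriv_smul
    MeasurableSet.univ (fun s _ => hasDerivWithinAt_mul_exp c s _) (injOn_mul_exp hc),
    integrableOn_univ] at hf
  simpa only [abs_of_pos (mul_pos hc (Real.exp_pos _)), smul_eq_mul] using hf

end ExpSubstitution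

theorem two_mul_macdonaldK {ν z : ℝ}
    (h : Integrable fun s : ℝ => Real.exp (-z * Real.cosh s + ν * s)) :
    2 * macdonaldK ν z = ∫ s, Real.exp (-z * Real.cosh s + ν * s) := by
  have hsplit : ∀ s, Real.exp (-z * Real.cosh s) * Real.cosh (ν * s) =
      2⁻¹ * (Real.exp (-z * Real.cosh s + ν * s) +
        Real.exp (-z * Real.cosh (-s) + ν * -s)) := fun s => by
    rw [Real.cosh_neg, Real.exp_add, Real.exp_add, Real.cosh_eq (ν * s), mul_neg]
    ring
  have heven : ∀ s : ℝ, Real.exp (-z * Real.cosh |s|) * Real.cosh (ν * |s|) =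
      Real.exp (-z * Real.cosh s) * Real.cosh (ν * s) := fun s => by
    rw [Real.cosh_abs]
    rcases abs_choice s with hs | hs <;> simp only [hs, mul_neg, Real.cosh_neg]
  rw [macdonaldK, ← integral_comp_abs]
  simp only [heven, hsplit]
  rw [integral_const_mul, integral_add h h.comp_neg,
    integral_neg_eq_self (fun s => Real.exp (-z * Real.cosh s + ν * s))]
  ring

-- The substitution `u = √x e^s` symmetrizes the exponent: `u + x / u = 2 √x cosh s`.
theorem mul_rpow_mul_exp_neg_sub_div {x : ℝ} (hx : 0 < x) (ν s : ℝ) :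
    √x * Real.exp s * ((√x * Real.exp s) ^ (ν - 1) *
        Real.exp (-(√x * Real.exp s) - x / (√x * Real.exp s))) =
      x ^ (ν / 2) * Real.exp (-(2 * √x) * Real.cosh s + ν * s) := by
  have hr : 0 < √x := Real.sqrt_pos.2 hx
  have hu : 0 < √x * Real.exp s := by positivity
  have hpow : √x * Real.exp s * (√x * Real.exp s) ^ (ν - 1) = x ^ (ν / 2) * Real.exp (ν * s) := by
    rw [mul_comm, ← Real.rpow_add_one hu.ne', sub_add_cancel,
      Real.mul_rpow hr.le (Real.exp_nonneg s), Real.sqrt_eq_rpow, ← Real.rpow_mul hx.le,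
      ← Real.exp_mul, mul_comm s]
    ring_nf
  have hdiv : x / (√x * Real.exp s) = √x * Real.exp (-s) := by
    rw [← div_div, Real.div_sqrt, Real.exp_neg, div_eq_mul_inv]
  rw [← mul_assoc, hpow, hdiv, mul_assoc, ← Real.exp_add, Real.cosh_eq]
  ring_nf

theorem rho_eq_integral {ν x : ℝ} (hν : 0 < ν) (hx : 0 ≤ x) :
    rho ν x = ∫ u in Set.Ioi (0 : ℝ), u ^ (ν - 1) * Real.exp (-u - x / u) := by
  rcases hx.eq_or_lt with rfl | hx
  · simp only [rho, if_pos, Real.Gamma_eq_integral hν, zero_div, sub_zero, mul_comm]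
  have hr : 0 < √x := Real.sqrt_pos.2 hx
  have hint : Integrable fun s => Real.exp (-(2 * √x) * Real.cosh s + ν * s) := by
    have h := integrable_mul_exp_of_integrableOn_Ioi hr
      (integrableOn_rpow_mul_exp_neg_sub_div hν hx.le)
    simp only [mul_rpow_mul_exp_neg_sub_div hx] at h
    exact (integrable_const_mul_iff (Real.rpow_pos_of_pos hx _).ne'.isUnit _).1 h
  rw [rho, if_neg hx.ne', mul_comm 2, mul_assoc, two_mul_macdonaldK hint,
    integral_Ioi_eq_integral_mul_exp hr]
  simp only [mul_rpow_mul_exp_neg_sub_div hx, integral_const_mul]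

theorem setIntegral_Ioi_pos {f : ℝ → ℝ} {c : ℝ} (hf : IntegrableOn f (Set.Ioi c))
    (hf₀ : ∀ u ∈ Set.Ioi c, 0 ≤ f u) (hfin : {u ∈ Set.Ioi c | f u = 0}.Finite) :
    0 < ∫ u in Set.Ioi c, f u := by
  rw [setIntegral_pos_iff_support_of_nonneg_ae
    ((ae_restrict_iff' measurableSet_Ioi).2 (ae_of_all _ hf₀)) hf]
  have hsupp : Function.support f ∩ Set.Ioi c = Set.Ioi c \ {u ∈ Set.Ioi c | f u = 0} := by
    ext u
    simp only [Set.mem_inter_iff, Function.mem_support, Set.mem_sdiff, Set.mem_ofPred_eq]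
    tauto
  rw [hsupp, measure_sdiff_null (hfin.measure_zero _), Real.volume_Ioi]
  exact ENNReal.zero_lt_top

theorem rho_pos {ν x : ℝ} (hν : 0 < ν) (hx : 0 ≤ x) : 0 < rho ν x := by
  have hpos : ∀ u ∈ Set.Ioi (0 : ℝ), 0 < u ^ (ν - 1) * Real.exp (-u - x / u) :=
    fun u hu => mul_pos (Real.rpow_pos_of_pos hu _) (Real.exp_pos _)
  rw [rho_eq_integral hν hx]
  refine setIntegral_Ioi_pos (integrableOn_rpow_mul_exp_neg_sub_div hν hx)
    (fun u hu => (hpos u hu).le) (Set.finite_empty.subset ?_)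
  exact fun u hu => (hpos u hu.1).ne' hu.2

theorem weight_pos {α ν l t x : ℝ} (hν : 0 < ν) (ht : 0 ≤ t) (hx : 0 < x) :
    0 < weight α ν l t x :=
  mul_pos (mul_pos (Real.rpow_pos_of_pos hx _) (Real.exp_pos _)) (rho_pos hν (by positivity))

end Macdonald

section MellinTransform

/-- The integrand in the representation `mellinRho` of the Mellin transform of the weight. -/
def mellinKernel (ν l t s u : ℝ) : ℝ := u ^ (ν - 1) * Real.exp (-u) * (l + t / u) ^ (-s)

/-- `1 / Γ(s)` times the Mellin transform at `s` of `x ↦ e^{-lx} ρ_ν(xt)`, obtained by integrating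
out `x` in the representation `rho_eq_integral`. -/
def mellinRho (ν l t s : ℝ) : ℝ := ∫ u in Set.Ioi (0 : ℝ), mellinKernel ν l t s u

variable {ν l t s : ℝ}

@[fun_prop]
theorem measurable_mellinKernel : Measurable (mellinKernel ν l t s) := by
  unfold mellinKernel
  fun_prop

theorem add_div_pos (hl : 0 ≤ l) (ht : 0 ≤ t) (hlt : 0 < l + t) {u : ℝ} (hu : 0 < u) :
    0 < l + t / u := by
  rcases hl.eq_or_lt with rfl | hl
  · rw [zero_add] at hlt ⊢
    positivity
  · positivity

theorem mellinKernel_pos (hl : 0 ≤ l) (ht : 0 ≤ t) (hlt : 0 < l + t) {u : ℝ} (hu : 0 < u) :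
    0 < mellinKernel ν l t s u := by
  have := add_div_pos hl ht hlt hu
  rw [mellinKernel]
  positivity

theorem rpow_neg_add_div_le {c : ℝ} (hl : 0 ≤ l) (ht : 0 ≤ t) (hs : 0 ≤ s) (hc : 0 < c)
    (hclt : c ≤ l + t) {u : ℝ} (hu : 0 < u) : (l + t / u) ^ (-s) ≤ c ^ (-s) * (1 + u ^ s) := by
  have hcs : 0 < c ^ (-s) := Real.rpow_pos_of_pos hc _
  have hus : 0 < u ^ s := Real.rpow_pos_of_pos hu _
  rcases le_total u 1 with hu1 | hu1
  · have hle : c ≤ l + t / u := hclt.trans (by gcongr; exact le_div_self ht hu hu1)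
    calc (l + t / u) ^ (-s) ≤ c ^ (-s) :=
        Real.rpow_le_rpow_of_nonpos hc hle (neg_nonpos.2 hs)
      _ ≤ c ^ (-s) * (1 + u ^ s) := le_mul_of_one_le_right hcs.le (by linarith)
  · have hle : c / u ≤ l + t / u := calc
      c / u ≤ (l + t) / u := by gcongr
      _ = l / u + t / u := add_div l t u
      _ ≤ l + t / u := by gcongr; exact div_le_self hl hu1
    calc (l + t / u) ^ (-s) ≤ (c / u) ^ (-s) :=
        Real.rpow_le_rpow_of_nonpos (by positivity) hle (neg_nonpos.2 hs)
      _ = c ^ (-s) * u ^ s := by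
        rw [Real.div_rpow hc.le hu.le, Real.rpow_neg hu.le, div_inv_eq_mul]
      _ ≤ c ^ (-s) * (1 + u ^ s) := by gcongr; linarith

/-- A majorant of `mellinKernel ν l t s`, uniform in `l + t ≥ c`. -/
def mellinMajorant (ν c s u : ℝ) : ℝ :=
  c ^ (-s) * (u ^ (ν - 1) * Real.exp (-u) + u ^ (ν + s - 1) * Real.exp (-u))

theorem integrableOn_mellinMajorant (hν : 0 < ν) (hs : 0 ≤ s) (c : ℝ) :
    IntegrableOn (mellinMajorant ν c s) (Set.Ioi 0) :=
  ((integrableOn_rpow_mul_exp_neg (by linarith)).add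
    (integrableOn_rpow_mul_exp_neg (by linarith))).const_mul _

theorem norm_mellinKernel_le {c : ℝ} (hl : 0 ≤ l) (ht : 0 ≤ t) (hs : 0 ≤ s) (hc : 0 < c)
    (hclt : c ≤ l + t) {u : ℝ} (hu : 0 < u) :
    ‖mellinKernel ν l t s u‖ ≤ mellinMajorant ν c s u := by
  rw [Real.norm_of_nonneg (mellinKernel_pos hl ht (hc.trans_le hclt) hu).le]
  calc mellinKernel ν l t s u
      ≤ u ^ (ν - 1) * Real.exp (-u) * (c ^ (-s) * (1 + u ^ s)) := by
        rw [mellinKernel]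
        gcongr
        exact rpow_neg_add_div_le hl ht hs hc hclt hu
    _ = mellinMajorant ν c s u := by
        rw [mellinMajorant, add_sub_right_comm, Real.rpow_add hu]
        ring

theorem integrableOn_mellinKernel (hν : 0 < ν) (hl : 0 ≤ l) (ht : 0 ≤ t) (hlt : 0 < l + t)
    (hs : 0 ≤ s) : IntegrableOn (mellinKernel ν l t s) (Set.Ioi 0) :=
  Integrable.mono' (integrableOn_mellinMajorant hν hs (l + t)) (by fun_prop) <|
    (ae_restrict_iff' measurableSet_Ioi).2 <| ae_of_all _ fun _ hu =>
      norm_mellinKernel_le hl ht hs hlt le_rfl hu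

theorem continuousOn_mellinRho (hν : 0 < ν) (hs : 0 ≤ s) :
    ContinuousOn (fun p : ℝ × ℝ => mellinRho ν p.1 p.2 s)
      {p | 0 ≤ p.1 ∧ 0 ≤ p.2 ∧ 0 < p.1 + p.2} := by
  rintro ⟨l, t⟩ ⟨hl : 0 ≤ l, ht : 0 ≤ t, hlt : 0 < l + t⟩
  have hnear : ∀ᶠ p : ℝ × ℝ in 𝓝 (l, t), (l + t) / 2 < p.1 + p.2 :=
    (continuous_fst.add continuous_snd).continuousAt.eventually_const_lt (half_lt_self hlt)
  refine continuousWithinAt_of_dominated (bound := mellinMajorant ν ((l + t) / 2) s)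
    (Eventually.of_forall fun _ => by fun_prop) ?_ (integrableOn_mellinMajorant hν hs _) ?_
  · filter_upwards [self_mem_nhdsWithin, nhdsWithin_le_nhds hnear] with p hp hpc
    exact (ae_restrict_iff' measurableSet_Ioi).2 <| ae_of_all _ fun _ hu =>
      norm_mellinKernel_le hp.1 hp.2.1 hs (half_pos hlt) hpc.le hu
  · filter_upwards [self_mem_ae_restrict measurableSet_Ioi] with u hu
    refine ContinuousAt.continuousWithinAt (continuousAt_const.mul (ContinuousAt.rpow_const ?_ ?_))
    · fun_prop
    · exact Or.inl (add_div_pos hl ht hlt hu).ne'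

theorem hasDerivAt_mellinRho_left (hν : 0 < ν) (hl : 0 < l) (ht : 0 ≤ t) (hs : 0 ≤ s) :
    HasDerivAt (fun l => mellinRho ν l t s) (-s * mellinRho ν l t (s + 1)) l := by
  have hderiv : ∀ u ∈ Set.Ioi (0 : ℝ), ∀ x ∈ Set.Ioi (l / 2),
      HasDerivAt (fun x => mellinKernel ν x t s u) (-s * mellinKernel ν x t (s + 1) u) x := by
    intro u (hu : 0 < u) x (hx : l / 2 < x)
    have hx0 : 0 < x := (half_pos hl).trans hx
    have hne : x + t / u ≠ 0 := by positivity
    refine ((((hasDerivAt_id x).add_const (t / u)).rpow_const (p := -s)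
      (Or.inl hne)).const_mul (u ^ (ν - 1) * Real.exp (-u))).congr_deriv ?_
    rw [mellinKernel, neg_add, ← sub_eq_add_neg, id_eq]
    ring
  have hbound : ∀ u ∈ Set.Ioi (0 : ℝ), ∀ x ∈ Set.Ioi (l / 2),
      ‖-s * mellinKernel ν x t (s + 1) u‖ ≤ s * mellinMajorant ν (l / 2) (s + 1) u := by
    intro u hu x (hx : l / 2 < x)
    rw [norm_mul, norm_neg, Real.norm_of_nonneg hs]
    have hx0 : 0 < x := (half_pos hl).trans hx
    gcongr
    exact norm_mellinKernel_le hx0.le ht (by positivity) (half_pos hl) (by linarith) hu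
  rw [mellinRho, ← integral_const_mul]
  exact (hasDerivAt_integral_of_dominated_loc_of_deriv_le (F := fun x => mellinKernel ν x t s)
    (Ioi_mem_nhds (half_lt_self hl))
    (Eventually.of_forall fun _ => by fun_prop)
    (integrableOn_mellinKernel hν hl.le ht (by positivity) hs) (by fun_prop)
    ((ae_restrict_iff' measurableSet_Ioi).2 (ae_of_all _ hbound))
    ((integrableOn_mellinMajorant hν (by positivity) _).const_mul s)
    ((ae_restrict_iff' measurableSet_Ioi).2 (ae_of_all _ hderiv))).2

theorem mellinRho_eq_rpow_mul (hl : 0 ≤ l) (ht : 0 < t) :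
    mellinRho ν l t s = t ^ (-s) * mellinRho ν (l / t) 1 s := by
  rw [mellinRho, mellinRho, ← integral_const_mul]
  refine setIntegral_congr_fun measurableSet_Ioi fun u (hu : 0 < u) => ?_
  have hfactor : l + t / u = t * (l / t + 1 / u) := by
    field_simp
  simp only [mellinKernel]
  rw [hfactor, Real.mul_rpow ht.le (by positivity)]
  ring

theorem hasDerivAt_mellinRho_right (hν : 0 < ν) (hl : 0 < l) (ht : 0 < t) (hs : 0 ≤ s) :
    HasDerivAt (fun t => mellinRho ν l t s)
      (t⁻¹ * (s * l * mellinRho ν l t (s + 1) - s * mellinRho ν l t s)) t := by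
  have hquot : HasDerivAt (fun t => l / t) (-l / t ^ 2) t :=
    ((hasDerivAt_const t l).fun_div (hasDerivAt_id t) ht.ne').congr_deriv (by simp)
  have hpow : HasDerivAt (fun t : ℝ => t ^ (-s)) (-s * t ^ (-s - 1)) t :=
    Real.hasDerivAt_rpow_const (Or.inl ht.ne')
  have hmellin := (hasDerivAt_mellinRho_left hν (div_pos hl ht) zero_le_one hs).comp t hquot
  refine ((hpow.mul hmellin).congr_deriv ?_).congr_of_eventuallyEq ?_
  · rw [mellinRho_eq_rpow_mul (s := s) hl.le ht, mellinRho_eq_rpow_mul (s := s + 1) hl.le ht,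
      Real.rpow_sub_one ht.ne', neg_add, ← sub_eq_add_neg, Real.rpow_sub_one ht.ne',
      Function.comp_apply]
    field_simp
    ring
  · filter_upwards [Ioi_mem_nhds ht] with y hy
    exact mellinRho_eq_rpow_mul hl.le hy

theorem mul_mellinRho_add_one_le (hν : 0 < ν) (hl : 0 ≤ l) (ht : 0 ≤ t) (hlt : 0 < l + t)
    (hs : 0 ≤ s) : l * mellinRho ν l t (s + 1) ≤ mellinRho ν l t s := by
  rw [mellinRho, mellinRho, ← integral_const_mul]
  refine setIntegral_mono_on ((integrableOn_mellinKernel hν hl ht hlt (by positivity)).const_mul l)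
    (integrableOn_mellinKernel hν hl ht hlt hs) measurableSet_Ioi fun u (hu : 0 < u) => ?_
  have hpos := add_div_pos hl ht hlt hu
  have hkernel : mellinKernel ν l t s u = (l + t / u) * mellinKernel ν l t (s + 1) u := by
    rw [mellinKernel, mellinKernel, neg_add, ← sub_eq_add_neg, Real.rpow_sub_one hpos.ne',
      mul_left_comm, mul_div_cancel₀ _ hpos.ne']
  rw [hkernel]
  have := (mellinKernel_pos (ν := ν) (s := s + 1) hl ht hlt hu).le
  gcongr
  exact le_add_of_nonneg_right (by positivity)

theorem mellinRho_zero_right (hν : 0 < ν) (l s : ℝ) :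
    mellinRho ν l 0 s = Real.Gamma ν * l ^ (-s) := by
  simp only [mellinRho, mellinKernel, zero_div, add_zero]
  rw [integral_mul_const, Real.Gamma_eq_integral hν]
  simp only [mul_comm]

end MellinTransform

section Fubini

variable {ν l t s : ℝ}

theorem rpow_mul_exp_mul_exp_sub_div (l t x s ν u : ℝ) :
    x ^ (s - 1) * Real.exp (-l * x) * (u ^ (ν - 1) * Real.exp (-u - x * t / u)) =
      u ^ (ν - 1) * Real.exp (-u) * (x ^ (s - 1) * Real.exp (-(l + t / u) * x)) := by
  have hexp : Real.exp (-l * x) * Real.exp (-u - x * t / u) =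
      Real.exp (-u) * Real.exp (-(l + t / u) * x) := by
    rw [← Real.exp_add, ← Real.exp_add]
    ring_nf
  linear_combination x ^ (s - 1) * u ^ (ν - 1) * hexp

theorem integral_rpow_mul_exp_eq_mellinKernel (hs : 0 < s) {u : ℝ} (hu : 0 < l + t / u) (ν : ℝ) :
    ∫ x in Set.Ioi (0 : ℝ),
        x ^ (s - 1) * Real.exp (-l * x) * (u ^ (ν - 1) * Real.exp (-u - x * t / u)) =
      Real.Gamma s * mellinKernel ν l t s u := by
  simp only [rpow_mul_exp_mul_exp_sub_div, integral_const_mul, neg_mul (l + t / u)]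
  rw [Real.integral_rpow_mul_exp_neg_mul_Ioi hs hu, mellinKernel, one_div, Real.inv_rpow hu.le,
    Real.rpow_neg hu.le]
  ring

theorem integral_mul_exp_eq_mul_rho (hν : 0 < ν) {x : ℝ} (hx : 0 ≤ x * t) (l s : ℝ) :
    ∫ u in Set.Ioi (0 : ℝ),
        x ^ (s - 1) * Real.exp (-l * x) * (u ^ (ν - 1) * Real.exp (-u - x * t / u)) =
      x ^ (s - 1) * Real.exp (-l * x) * rho ν (x * t) := by
  rw [rho_eq_integral hν hx, integral_const_mul]

variable (hν : 0 < ν) (hl : 0 ≤ l) (ht : 0 ≤ t) (hlt : 0 < l + t) (hs : 0 < s)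
include hν hl ht hlt hs

theorem integrable_rpow_mul_exp_mul_exp_sub_div :
    Integrable (Function.uncurry fun x u : ℝ =>
      x ^ (s - 1) * Real.exp (-l * x) * (u ^ (ν - 1) * Real.exp (-u - x * t / u)))
      ((volume.restrict (Set.Ioi 0)).prod (volume.restrict (Set.Ioi 0))) := by
  rw [integrable_prod_iff' (Measurable.aestronglyMeasurable (by fun_prop))]
  constructor
  · filter_upwards [self_mem_ae_restrict measurableSet_Ioi] with u hu
    simp only [Function.uncurry_apply_pair, rpow_mul_exp_mul_exp_sub_div]
    exact (integrableOn_rpow_mul_exp_neg_mul (by linarith) (add_div_pos hl ht hlt hu)).const_mul _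
  · refine ((integrableOn_mellinKernel hν hl ht hlt hs.le).const_mul (Real.Gamma s)).congr ?_
    filter_upwards [self_mem_ae_restrict measurableSet_Ioi] with u (hu : 0 < u)
    rw [← integral_rpow_mul_exp_eq_mellinKernel hs (add_div_pos hl ht hlt hu)]
    refine setIntegral_congr_fun measurableSet_Ioi fun x (hx : 0 < x) => ?_
    exact (Real.norm_of_nonneg (by positivity)).symm

theorem integrableOn_rpow_mul_exp_mul_rho :
    IntegrableOn (fun x : ℝ => x ^ (s - 1) * Real.exp (-l * x) * rho ν (x * t)) (Set.Ioi 0) :=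
  (integrableOn_congr_fun (fun _ hx => integral_mul_exp_eq_mul_rho hν
    (mul_nonneg (le_of_lt hx) ht) l s) measurableSet_Ioi).1
    (integrable_rpow_mul_exp_mul_exp_sub_div hν hl ht hlt hs).integral_prod_left

theorem integral_rpow_mul_exp_mul_rho :
    ∫ x in Set.Ioi (0 : ℝ), x ^ (s - 1) * Real.exp (-l * x) * rho ν (x * t) =
      Real.Gamma s * mellinRho ν l t s := by
  calc ∫ x in Set.Ioi (0 : ℝ), x ^ (s - 1) * Real.exp (-l * x) * rho ν (x * t)
      = ∫ x in Set.Ioi (0 : ℝ), ∫ u in Set.Ioi (0 : ℝ),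
          x ^ (s - 1) * Real.exp (-l * x) * (u ^ (ν - 1) * Real.exp (-u - x * t / u)) :=
        setIntegral_congr_fun measurableSet_Ioi fun x hx =>
          (integral_mul_exp_eq_mul_rho hν (mul_nonneg (le_of_lt hx) ht) l s).symm
    _ = ∫ u in Set.Ioi (0 : ℝ), ∫ x in Set.Ioi (0 : ℝ),
          x ^ (s - 1) * Real.exp (-l * x) * (u ^ (ν - 1) * Real.exp (-u - x * t / u)) :=
        integral_integral_swap (integrable_rpow_mul_exp_mul_exp_sub_div hν hl ht hlt hs)
    _ = ∫ u in Set.Ioi (0 : ℝ), Real.Gamma s * mellinKernel ν l t s u :=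
        setIntegral_congr_fun measurableSet_Ioi fun u hu =>
          integral_rpow_mul_exp_eq_mellinKernel hs (add_div_pos hl ht hlt hu) ν
    _ = Real.Gamma s * mellinRho ν l t s := integral_const_mul _ _

end Fubini

section WeightFunctional

/-- Standing assumptions on the parameters, under which the weight `x^α e^{-lx} ρ_ν(xt)` has moments
of all orders. -/
structure IsAdmissible (α ν l t : ℝ) : Prop where
  neg_one_lt : -1 < α
  pos : 0 < ν
  left_nonneg : 0 ≤ l
  right_nonneg : 0 ≤ t
  add_pos : 0 < l + t

/-- The linear functional on polynomials whose moments are those of the weight. Unlike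
`functional`, it is linear for all values of the parameters. -/
def weightFunctional (α ν l t : ℝ) : ℝ[X] →ₗ[ℝ] ℝ :=
  (basisMonomials ℝ).constr ℝ fun k =>
    Real.Gamma (α + k + 1) * mellinRho ν l t (α + k + 1)

theorem weightFunctional_X_pow (α ν l t : ℝ) (k : ℕ) : weightFunctional α ν l t (X ^ k) =
    Real.Gamma (α + k + 1) * mellinRho ν l t (α + k + 1) := by
  have h := (basisMonomials ℝ).constr_basis ℝ
    (fun k : ℕ => Real.Gamma (α + k + 1) * mellinRho ν l t (α + k + 1)) k
  simpa only [weightFunctional, coe_basisMonomials, monomial_one_right_eq_X_pow] using h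

theorem add_natCast_add_one_pos {α : ℝ} (hα : -1 < α) (k : ℕ) : 0 < α + k + 1 := by
  have : (0 : ℝ) ≤ k := k.cast_nonneg
  linarith

variable {α ν l t : ℝ}

namespace IsAdmissible

theorem of_left_pos (hα : -1 < α) (hν : 0 < ν) (hl : 0 < l) (ht : 0 ≤ t) : IsAdmissible α ν l t :=
  ⟨hα, hν, hl.le, ht, by positivity⟩

theorem of_right_pos (hα : -1 < α) (hν : 0 < ν) (hl : 0 ≤ l) (ht : 0 < t) :
    IsAdmissible α ν l t :=
  ⟨hα, hν, hl, ht.le, by positivity⟩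

variable (h : IsAdmissible α ν l t)
include h

theorem integrableOn_pow_mul_weight (k : ℕ) :
    IntegrableOn (fun x : ℝ => x ^ k * weight α ν l t x) (Set.Ioi 0) := by
  refine (integrableOn_rpow_mul_exp_mul_rho h.pos h.left_nonneg h.right_nonneg h.add_pos
    (add_natCast_add_one_pos h.neg_one_lt k)).congr_fun (fun x hx => ?_) measurableSet_Ioi
  simp only [weight, add_sub_cancel_right, Real.rpow_add hx, Real.rpow_natCast]
  ring

theorem integral_pow_mul_weight (k : ℕ) :
    ∫ x in Set.Ioi (0 : ℝ), x ^ k * weight α ν l t x = weightFunctional α ν l t (X ^ k) := by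
  rw [weightFunctional_X_pow, ← integral_rpow_mul_exp_mul_rho h.pos h.left_nonneg h.right_nonneg
    h.add_pos (add_natCast_add_one_pos h.neg_one_lt k)]
  refine setIntegral_congr_fun measurableSet_Ioi fun x hx => ?_
  simp only [weight, add_sub_cancel_right, Real.rpow_add hx, Real.rpow_natCast]
  ring

theorem integrableOn_eval_mul_weight (q : ℝ[X]) :
    IntegrableOn (fun x : ℝ => q.eval x * weight α ν l t x) (Set.Ioi 0) := by
  simp only [eval_eq_sum_range, Finset.sum_mul, mul_assoc]
  exact integrable_finsetSum _ fun k _ => (h.integrableOn_pow_mul_weight k).const_mul _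

theorem functional_eq (q : ℝ[X]) : functional α ν l t q = weightFunctional α ν l t q := by
  rw [map_eq_sum_range (weightFunctional α ν l t) le_rfl]
  simp only [functional, eval_eq_sum_range, Finset.sum_mul, mul_assoc]
  rw [integral_finsetSum _ fun k _ => (h.integrableOn_pow_mul_weight k).const_mul _]
  simp only [integral_const_mul, h.integral_pow_mul_weight]

theorem isPositive : IsPositive (weightFunctional α ν l t) := fun q hq => by
  have hw : ∀ x ∈ Set.Ioi (0 : ℝ), 0 < weight α ν l t x := fun x hx =>
    weight_pos h.pos h.right_nonneg hx
  rw [← h.functional_eq]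
  refine setIntegral_Ioi_pos (h.integrableOn_eval_mul_weight _) (fun x hx => ?_)
    ((finite_setOfPred_isRoot hq).subset fun x hx => ?_)
  · rw [eval_pow]
    exact mul_nonneg (sq_nonneg _) (hw x hx).le
  · have hroot := (mul_eq_zero.1 hx.2).resolve_right (hw x hx.1).ne'
    rw [eval_pow] at hroot
    exact pow_eq_zero_iff two_ne_zero |>.1 hroot

theorem isQuasiDefinite : IsQuasiDefinite (weightFunctional α ν l t) :=
  h.isPositive.isQuasiDefinite

theorem monicP_eq (n : ℕ) : monicP α ν l t n = monicOrthogonal (weightFunctional α ν l t) n := by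
  induction n using Nat.strong_induction_on with
  | _ n ih =>
    rw [monicP, monicOrthogonal]
    simp only [h.functional_eq, fun k : Fin n => ih k k.isLt]

theorem P_eq (n : ℕ) : P α ν l t n = orthonormalPoly (weightFunctional α ν l t) n := by
  rw [P, h.monicP_eq, h.functional_eq, orthonormalPoly, leadCoeff, sqNorm]

theorem a_eq (n : ℕ) : a α ν l t n = leadCoeff (weightFunctional α ν l t) n := by
  rw [a, h.P_eq, coeff_orthonormalPoly_self]

theorem b_eq (n : ℕ) :
    b α ν l t n = a α ν l t n * (monicOrthogonal (weightFunctional α ν l t) n).nextCoeff := by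
  cases n with
  | zero => rw [b, nextCoeff, natDegree_monicOrthogonal, if_pos rfl, mul_zero]
  | succ n =>
    rw [b, h.P_eq, orthonormalPoly, coeff_C_mul, h.a_eq, nextCoeff, natDegree_monicOrthogonal,
      if_neg n.succ_ne_zero, Nat.add_sub_cancel]

theorem a_ne_zero (n : ℕ) : a α ν l t n ≠ 0 := by
  rw [h.a_eq]
  exact h.isPositive.leadCoeff_ne_zero n

theorem A_succ_eq (n : ℕ) : A α ν l t (n + 1) = leadCoeff (weightFunctional α ν l t) n /
    leadCoeff (weightFunctional α ν l t) (n + 1) := by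
  rw [A, h.a_eq, h.a_eq]

theorem B_eq (n : ℕ) : B α ν l t n = diagCoeff (weightFunctional α ν l t) n := by
  rw [B, h.b_eq, h.b_eq, mul_div_cancel_left₀ _ (h.a_ne_zero n),
    mul_div_cancel_left₀ _ (h.a_ne_zero (n + 1)), diagCoeff]

theorem natDegree_P (n : ℕ) : (P α ν l t n).natDegree = n := by
  rw [h.P_eq, h.isPositive.natDegree_orthonormalPoly]

theorem neg_one_pow_mul_a_pos (n : ℕ) : 0 < (-1) ^ n * a α ν l t n := by
  rw [h.a_eq]
  exact h.isPositive.neg_one_pow_mul_leadCoeff_pos n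

theorem integrableOn_P_mul_P_mul_weight (m k : ℕ) :
    IntegrableOn (fun x : ℝ => (P α ν l t m).eval x * (P α ν l t k).eval x * weight α ν l t x)
      (Set.Ioi 0) := by
  simpa only [eval_mul] using h.integrableOn_eval_mul_weight (P α ν l t m * P α ν l t k)

theorem integral_P_mul_P_mul_weight (m k : ℕ) :
    ∫ x in Set.Ioi (0 : ℝ), (P α ν l t m).eval x * (P α ν l t k).eval x * weight α ν l t x =
      if m = k then 1 else 0 := by
  simpa only [functional, eval_mul, h.P_eq, h.isPositive.apply_orthonormalPoly_mul] using
    h.functional_eq (P α ν l t m * P α ν l t k)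

end IsAdmissible

theorem continuousOn_weightFunctional_X_pow (hα : -1 < α) (hν : 0 < ν) (k : ℕ) :
    ContinuousOn (fun p : ℝ × ℝ => weightFunctional α ν p.1 p.2 (X ^ k))
      {p | 0 ≤ p.1 ∧ 0 ≤ p.2 ∧ 0 < p.1 + p.2} := by
  simp only [weightFunctional_X_pow]
  exact (continuousOn_mellinRho hν (add_natCast_add_one_pos hα k).le).const_mul _

end WeightFunctional

section LeftFlow

variable {α ν l t : ℝ}

theorem continuousOn_weightFunctional_left (hα : -1 < α) (hν : 0 < ν) (ht : 0 < t) (k : ℕ) :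
    ContinuousOn (fun l => weightFunctional α ν l t (X ^ k)) (Set.Ici 0) :=
  (continuousOn_weightFunctional_X_pow hα hν k).comp (f := fun l => (l, t)) (by fun_prop)
    fun _ hl => ⟨hl, ht.le, add_pos_of_nonneg_of_pos hl ht⟩

theorem hasDerivAt_weightFunctional_left (hα : -1 < α) (hν : 0 < ν) (hl : 0 < l) (ht : 0 ≤ t)
    (k : ℕ) : HasDerivAt (fun l => weightFunctional α ν l t (X ^ k))
      (-weightFunctional α ν l t (X ^ (k + 1))) l := by
  have hk := add_natCast_add_one_pos hα k
  simp only [weightFunctional_X_pow]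
  refine ((hasDerivAt_mellinRho_left hν hl ht hk.le).const_mul _).congr_deriv ?_
  rw [Nat.cast_add_one, ← add_assoc α, Real.Gamma_add_one hk.ne']
  ring

theorem hasDerivAt_eval_P_left (hα : -1 < α) (hν : 0 < ν) (hl : 0 < l) (ht : 0 ≤ t) (n : ℕ)
    (x : ℝ) : HasDerivAt (fun l => (P α ν l t (n + 1)).eval x)
      (1 / 2 * B α ν l t (n + 1) * (P α ν l t (n + 1)).eval x +
        A α ν l t (n + 1) * (P α ν l t n).eval x) l := by
  have h := IsAdmissible.of_left_pos hα hν hl ht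
  have hnear : ∀ᶠ l in 𝓝 l, IsAdmissible α ν l t := by
    filter_upwards [Ioi_mem_nhds hl] with y hy using .of_left_pos hα hν hy ht
  rw [h.B_eq, h.A_succ_eq, h.P_eq, h.P_eq, one_div_mul_eq_div]
  refine (hasDerivAt_eval_orthonormalPoly_toda (hasDerivAt_weightFunctional_left hα hν hl ht)
    (hnear.mono fun _ hy => hy.isPositive) n x).congr_of_eventuallyEq ?_
  exact hnear.mono fun y hy => by simp only [hy.P_eq]

section

variable (hα : -1 < α) (hν : 0 < ν) (ht : 0 < t)
include hα hν ht

theorem continuousOn_eval_P_left (n : ℕ) (x : ℝ) :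
    ContinuousOn (fun l => (P α ν l t n).eval x) (Set.Ici 0) :=
  (continuousOn_eval_orthonormalPoly (continuousOn_weightFunctional_left hα hν ht)
    (fun _ hl => (IsAdmissible.of_right_pos hα hν hl ht).isPositive) n x).congr
    fun _ hl => by simp only [(IsAdmissible.of_right_pos hα hν hl ht).P_eq]

theorem continuousOn_A_left (n : ℕ) : ContinuousOn (fun l => A α ν l t (n + 1)) (Set.Ici 0) := by
  have ha := continuousOn_leadCoeff (continuousOn_weightFunctional_left hα hν ht)
    fun _ hl => (IsAdmissible.of_right_pos hα hν hl ht).isPositive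
  exact ((ha n).div (ha (n + 1)) fun _ hl =>
    (IsAdmissible.of_right_pos hα hν hl ht).isPositive.leadCoeff_ne_zero (n + 1)).congr
    fun _ hl => (IsAdmissible.of_right_pos hα hν hl ht).A_succ_eq n

theorem continuousOn_B_left (n : ℕ) : ContinuousOn (fun l => B α ν l t n) (Set.Ici 0) :=
  (continuousOn_diagCoeff (continuousOn_weightFunctional_left hα hν ht)
    (fun _ hl => (IsAdmissible.of_right_pos hα hν hl ht).isQuasiDefinite) n).congr
    fun _ hl => (IsAdmissible.of_right_pos hα hν hl ht).B_eq n

variable (hl : 0 ≤ l) (n : ℕ)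
include hl

theorem intervalIntegrable_B_left : IntervalIntegrable (fun y => B α ν y t n) volume 0 l :=
  ((continuousOn_B_left hα hν ht n).mono Set.Icc_subset_Ici_self).intervalIntegrable_of_Icc hl

theorem intervalIntegrable_exp_mul_A_mul_P (x : ℝ) :
    IntervalIntegrable (fun ξ => Real.exp (1 / 2 * ∫ y in ξ..l, B α ν y t (n + 1)) *
      A α ν ξ t (n + 1) * (P α ν ξ t n).eval x) volume 0 l := by
  have hIcc : Set.uIcc 0 l ⊆ Set.Ici 0 := by
    rw [Set.uIcc_of_le hl]
    exact Set.Icc_subset_Ici_self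
  have hexp := continuousOn_exp_integral_left
    (((continuousOn_B_left hα hν ht (n + 1)).mono hIcc).const_mul (1 / 2))
  simp only [intervalIntegral.integral_const_mul] at hexp
  exact ((hexp.mul ((continuousOn_A_left hα hν ht n).mono hIcc)).mul
    ((continuousOn_eval_P_left hα hν ht n x).mono hIcc)).intervalIntegrable

theorem eval_P_eq_integral_left (x : ℝ) :
    (P α ν l t (n + 1)).eval x =
      (∫ ξ in (0 : ℝ)..l, Real.exp (1 / 2 * ∫ y in ξ..l, B α ν y t (n + 1)) *
        A α ν ξ t (n + 1) * (P α ν ξ t n).eval x) +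
      Real.exp (1 / 2 * ∫ y in (0 : ℝ)..l, B α ν y t (n + 1)) * (P α ν 0 t (n + 1)).eval x := by
  have hIcc : Set.Icc 0 l ⊆ Set.Ici 0 := Set.Icc_subset_Ici_self
  have h := eq_integral_exp_smul_add_of_hasDerivAt hl
    ((continuousOn_eval_P_left hα hν ht (n + 1) x).mono hIcc)
    (((continuousOn_B_left hα hν ht (n + 1)).mono hIcc).const_mul (1 / 2))
    (((continuousOn_A_left hα hν ht n).fun_mul (continuousOn_eval_P_left hα hν ht n x)).mono hIcc)
    fun ξ hξ => hasDerivAt_eval_P_left hα hν hξ.1 ht.le n x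
  simpa only [intervalIntegral.integral_const_mul, smul_eq_mul, ← mul_assoc] using h

end

end LeftFlow

section RightFlow

/-- The derivative of `weightFunctional α ν l t` with respect to `t`, for `t > 0`. -/
def weightFunctionalDeriv (α ν l t : ℝ) : ℝ[X] →ₗ[ℝ] ℝ :=
  t⁻¹ • (l • (weightFunctional α ν l t ∘ₗ mulX) - (α + 1) • weightFunctional α ν l t -
    weightFunctional α ν l t ∘ₗ euler)

variable {α ν l t : ℝ}

theorem weightFunctionalDeriv_X_pow (α ν l t : ℝ) (k : ℕ) :
    weightFunctionalDeriv α ν l t (X ^ k) = t⁻¹ * (l * weightFunctional α ν l t (X ^ (k + 1)) -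
      (α + k + 1) * weightFunctional α ν l t (X ^ k)) := by
  have heuler : euler (X ^ k : ℝ[X]) = (k : ℝ) • X ^ k := by
    cases k with
    | zero => simp only [euler_apply, pow_zero, derivative_one, mul_zero, Nat.cast_zero, zero_smul]
    | succ k =>
      rw [euler_apply, derivative_X_pow, Nat.add_sub_cancel, mul_left_comm, ← pow_succ',
        smul_eq_C_mul]
  simp only [weightFunctionalDeriv, LinearMap.smul_apply, LinearMap.sub_apply,
    LinearMap.comp_apply, mulX_apply, heuler, map_smul, smul_eq_mul, ← pow_succ']
  ring

theorem eval_firstVariation_weightFunctionalDeriv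
    (h : IsQuasiDefinite (weightFunctional α ν l t)) (n : ℕ) (x : ℝ) :
    (firstVariation (weightFunctional α ν l t) (n + 1) (weightFunctionalDeriv α ν l t)).eval x =
      (x * (monicOrthogonal (weightFunctional α ν l t) (n + 1)).derivative.eval x -
        (n + 1 : ℕ) * (monicOrthogonal (weightFunctional α ν l t) (n + 1)).eval x -
        l * (sqNorm (weightFunctional α ν l t) (n + 1) / sqNorm (weightFunctional α ν l t) n *
          (monicOrthogonal (weightFunctional α ν l t) n).eval x)) / t := by
  rw [weightFunctionalDeriv, map_smul, map_sub, map_sub, map_smul, map_smul,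
    h.firstVariation_comp_mulX, h.firstVariation_self, h.firstVariation_comp_euler]
  simp only [eval_smul, eval_sub, eval_neg, eval_mul, eval_X, smul_zero, eval_zero, smul_eq_mul]
  ring

theorem IsAdmissible.eval_firstVariation_weightFunctionalDeriv (h : IsAdmissible α ν l t) (n : ℕ)
    (x : ℝ) :
    (firstVariation (weightFunctional α ν l t) (n + 1) (weightFunctionalDeriv α ν l t)).eval x =
      (x * (P α ν l t (n + 1)).derivative.eval x - (n + 1 : ℕ) * (P α ν l t (n + 1)).eval x -
        l * A α ν l t (n + 1) * (P α ν l t n).eval x) / (t * a α ν l t (n + 1)) := by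
  have hne := h.isPositive.leadCoeff_ne_zero (n + 1)
  have hderiv : (P α ν l t (n + 1)).derivative.eval x = a α ν l t (n + 1) *
      (monicOrthogonal (weightFunctional α ν l t) (n + 1)).derivative.eval x := by
    rw [h.P_eq, h.a_eq, orthonormalPoly, derivative_C_mul, eval_mul, eval_C]
  rw [PrudnikovLaguerre.eval_firstVariation_weightFunctionalDeriv h.isQuasiDefinite, hderiv,
    mul_assoc l, h.A_succ_eq, h.P_eq, h.P_eq, h.a_eq,
    ← h.isPositive.leadCoeff_mul_eval_monicOrthogonal_pred, eval_orthonormalPoly,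
    ← mul_div_mul_left _ t hne]
  ring

section

variable (hα : -1 < α) (hν : 0 < ν) (hl : 0 < l)
include hα hν hl

theorem continuousOn_weightFunctional_right (k : ℕ) :
    ContinuousOn (fun t => weightFunctional α ν l t (X ^ k)) (Set.Ici 0) :=
  (continuousOn_weightFunctional_X_pow hα hν k).comp (f := fun t => (l, t)) (by fun_prop)
    fun _ ht => ⟨hl.le, ht, add_pos_of_pos_of_nonneg hl ht⟩

theorem hasDerivAt_weightFunctional_right (ht : 0 < t) (k : ℕ) :
    HasDerivAt (fun t => weightFunctional α ν l t (X ^ k))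
      (weightFunctionalDeriv α ν l t (X ^ k)) t := by
  have hk := add_natCast_add_one_pos hα k
  rw [weightFunctionalDeriv_X_pow]
  simp only [weightFunctional_X_pow]
  refine ((hasDerivAt_mellinRho_right hν hl ht hk.le).const_mul _).congr_deriv ?_
  rw [Nat.cast_add_one, ← add_assoc α, Real.Gamma_add_one hk.ne']
  ring

theorem weightFunctionalDeriv_X_pow_nonpos (ht : 0 < t) (k : ℕ) :
    weightFunctionalDeriv α ν l t (X ^ k) ≤ 0 := by
  have hk := add_natCast_add_one_pos hα k
  have hle := mul_mellinRho_add_one_le hν hl.le ht.le (by positivity) hk.le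
  rw [weightFunctionalDeriv_X_pow]
  refine mul_nonpos_of_nonneg_of_nonpos (inv_nonneg.2 ht.le) (sub_nonpos.2 ?_)
  rw [weightFunctional_X_pow, weightFunctional_X_pow, Nat.cast_add_one, ← add_assoc α,
    Real.Gamma_add_one hk.ne']
  calc l * ((α + k + 1) * Real.Gamma (α + k + 1) * mellinRho ν l t (α + k + 1 + 1))
      = (α + k + 1) * Real.Gamma (α + k + 1) * (l * mellinRho ν l t (α + k + 1 + 1)) := by ring
    _ ≤ (α + k + 1) * Real.Gamma (α + k + 1) * mellinRho ν l t (α + k + 1) := by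
        have := Real.Gamma_pos_of_pos hk
        gcongr
    _ = (α + k + 1) * (Real.Gamma (α + k + 1) * mellinRho ν l t (α + k + 1)) := mul_assoc _ _ _

variable (ht : 0 ≤ t)
include ht

-- The derivative may be singular at `t = 0`; it is integrable there because it has constant sign.
theorem intervalIntegrable_weightFunctionalDeriv (k : ℕ) :
    IntervalIntegrable (fun y => weightFunctionalDeriv α ν l y (X ^ k)) volume 0 t := by
  have hneg := intervalIntegral.intervalIntegrable_deriv_of_nonneg (a := 0) (b := t)
    (g := fun y => -weightFunctional α ν l y (X ^ k))
    (g' := fun y => -weightFunctionalDeriv α ν l y (X ^ k)) ?_ ?_ ?_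
  · simpa only [Pi.neg_def, neg_neg] using hneg.neg
  · rw [Set.uIcc_of_le ht]
    exact ((continuousOn_weightFunctional_right hα hν hl k).mono Set.Icc_subset_Ici_self).neg
  · rw [min_eq_left ht]
    exact fun y hy => (hasDerivAt_weightFunctional_right hα hν hl hy.1 k).fun_neg
  · rw [min_eq_left ht]
    exact fun y hy => neg_nonneg.2 (weightFunctionalDeriv_X_pow_nonpos hα hν hl hy.1 k)

theorem intervalIntegrable_eval_firstVariation_weightFunctionalDeriv (n : ℕ) (x : ℝ) :
    IntervalIntegrable (fun y => (firstVariation (weightFunctional α ν l y) n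
      (weightFunctionalDeriv α ν l y)).eval x) volume 0 t := by
  have hIcc : Set.uIcc 0 t ⊆ Set.Ici 0 := by
    rw [Set.uIcc_of_le ht]
    exact Set.Icc_subset_Ici_self
  exact intervalIntegrable_eval_firstVariation
    (fun k => (continuousOn_weightFunctional_right hα hν hl k).mono hIcc)
    (fun y hy => (IsAdmissible.of_left_pos hα hν hl (hIcc hy)).isQuasiDefinite)
    (intervalIntegrable_weightFunctionalDeriv hα hν hl ht) n x

theorem integral_eval_firstVariation_weightFunctionalDeriv (n : ℕ) (x : ℝ) :
    ∫ y in (0 : ℝ)..t, (firstVariation (weightFunctional α ν l y) n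
      (weightFunctionalDeriv α ν l y)).eval x =
      (monicOrthogonal (weightFunctional α ν l t) n).eval x -
        (monicOrthogonal (weightFunctional α ν l 0) n).eval x := by
  have hquasi : ∀ y ∈ Set.Ici (0 : ℝ), IsQuasiDefinite (weightFunctional α ν l y) :=
    fun y hy => (IsAdmissible.of_left_pos hα hν hl hy).isQuasiDefinite
  refine intervalIntegral.integral_eq_sub_of_hasDerivAt_of_le
    (f := fun y => (monicOrthogonal (weightFunctional α ν l y) n).eval x) ht
    ((continuousOn_eval_monicOrthogonal (continuousOn_weightFunctional_right hα hν hl)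
      hquasi n x).mono Set.Icc_subset_Ici_self) (fun y hy => ?_)
    (intervalIntegrable_eval_firstVariation_weightFunctionalDeriv hα hν hl ht n x)
  refine hasDerivAt_eval_monicOrthogonal (hasDerivAt_weightFunctional_right hα hν hl hy.1) ?_ n x
  filter_upwards [Ici_mem_nhds hy.1] with z hz using hquasi z hz

theorem eqOn_eval_firstVariation_weightFunctionalDeriv (n : ℕ) (x : ℝ) :
    Set.EqOn (fun y => (firstVariation (weightFunctional α ν l y) (n + 1)
      (weightFunctionalDeriv α ν l y)).eval x)
      (fun y => (x * (P α ν l y (n + 1)).derivative.eval x -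
        (n + 1 : ℕ) * (P α ν l y (n + 1)).eval x -
        l * A α ν l y (n + 1) * (P α ν l y n).eval x) / (y * a α ν l y (n + 1)))
      (Set.uIcc 0 t) := fun _ hy =>
  IsAdmissible.eval_firstVariation_weightFunctionalDeriv
    (.of_left_pos hα hν hl ((Set.uIcc_of_le ht).subset hy).1) n x

theorem intervalIntegrable_right (n : ℕ) (x : ℝ) :
    IntervalIntegrable (fun y => (x * (P α ν l y (n + 1)).derivative.eval x -
      (n + 1 : ℕ) * (P α ν l y (n + 1)).eval x -
      l * A α ν l y (n + 1) * (P α ν l y n).eval x) / (y * a α ν l y (n + 1))) volume 0 t :=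
  (intervalIntegrable_eval_firstVariation_weightFunctionalDeriv hα hν hl ht (n + 1) x).congr
    ((eqOn_eval_firstVariation_weightFunctionalDeriv hα hν hl ht n x).mono Set.uIoc_subset_uIcc)

theorem eval_P_eq_integral_right (n : ℕ) (x : ℝ) :
    (P α ν l t (n + 1)).eval x = a α ν l t (n + 1) *
      (∫ y in (0 : ℝ)..t, (x * (P α ν l y (n + 1)).derivative.eval x -
        (n + 1 : ℕ) * (P α ν l y (n + 1)).eval x -
        l * A α ν l y (n + 1) * (P α ν l y n).eval x) / (y * a α ν l y (n + 1))) +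
      (a α ν l 0 (n + 1))⁻¹ * a α ν l t (n + 1) * (P α ν l 0 (n + 1)).eval x := by
  have h := IsAdmissible.of_left_pos hα hν hl ht
  have h₀ := IsAdmissible.of_left_pos hα hν hl le_rfl
  rw [← intervalIntegral.integral_congr (eqOn_eval_firstVariation_weightFunctionalDeriv
    hα hν hl ht n x), integral_eval_firstVariation_weightFunctionalDeriv hα hν hl ht, h.P_eq,
    h₀.P_eq, eval_orthonormalPoly, eval_orthonormalPoly, h.a_eq, h₀.a_eq]
  have := h₀.isPositive.leadCoeff_ne_zero (n + 1)
  field_simp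
  ring

end

end RightFlow

section Laguerre

variable {α ν l : ℝ}

theorem Gamma_add_natCast {x : ℝ} (hx : 0 < x) (j : ℕ) :
    Real.Gamma (x + j) = (ascPochhammer ℝ j).eval x * Real.Gamma x := by
  induction j with
  | zero => rw [Nat.cast_zero, add_zero, ascPochhammer_zero, eval_one, one_mul]
  | succ j ih =>
    rw [ascPochhammer_succ_eval, Nat.cast_succ, ← add_assoc, Real.Gamma_add_one (by positivity), ih]
    ring

theorem coeff_laguerre (α : ℝ) (n k : ℕ) : (laguerre α n).coeff k =
    if k ≤ n then (-1) ^ k * Real.Gamma (n + α + 1) /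
      (Real.Gamma (k + α + 1) * ((n - k)! : ℕ) * (k ! : ℕ)) else 0 := by
  simp [laguerre, finsetSum_coeff, coeff_C_mul, coeff_X_pow]

theorem Gamma_natCast_add_pos (hα : -1 < α) (n : ℕ) : 0 < Real.Gamma (n + α + 1) :=
  add_comm α n ▸ Real.Gamma_pos_of_pos (add_natCast_add_one_pos hα n)

theorem coeff_laguerre_self (hα : -1 < α) (n : ℕ) : (laguerre α n).coeff n = (-1) ^ n / n ! := by
  have := (Gamma_natCast_add_pos hα n).ne'
  rw [coeff_laguerre, if_pos le_rfl, Nat.sub_self, Nat.factorial_zero, Nat.cast_one]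
  field_simp

/-- The Laguerre polynomial in the variable `l x`, normalized to be monic. -/
def monicLaguerre (α l : ℝ) (n : ℕ) : ℝ[X] :=
  C ((-1) ^ n * n ! / l ^ n) * (laguerre α n).comp (C l * X)

theorem coeff_monicLaguerre (α l : ℝ) (n k : ℕ) : (monicLaguerre α l n).coeff k =
    (-1) ^ n * n ! / l ^ n * ((laguerre α n).coeff k * l ^ k) := by
  rw [monicLaguerre, coeff_C_mul, comp_C_mul_X_coeff]

theorem natDegree_monicLaguerre_le (α l : ℝ) (n : ℕ) : (monicLaguerre α l n).natDegree ≤ n :=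
  natDegree_le_iff_coeff_eq_zero.2 fun k hk => by
    rw [coeff_monicLaguerre, coeff_laguerre, if_neg hk.not_ge, zero_mul, mul_zero]

theorem coeff_monicLaguerre_self (hα : -1 < α) (hl : 0 < l) (n : ℕ) :
    (monicLaguerre α l n).coeff n = 1 := by
  have hsign : ((-1 : ℝ) ^ n) ^ 2 = 1 := by rw [pow_right_comm, neg_one_sq, one_pow]
  rw [coeff_monicLaguerre, coeff_laguerre_self hα]
  field_simp
  exact hsign

theorem monic_monicLaguerre (hα : -1 < α) (hl : 0 < l) (n : ℕ) : (monicLaguerre α l n).Monic :=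
  monic_of_natDegree_le_of_coeff_eq_one n (natDegree_monicLaguerre_le α l n)
    (coeff_monicLaguerre_self hα hl n)

theorem natDegree_monicLaguerre (hα : -1 < α) (hl : 0 < l) (n : ℕ) :
    (monicLaguerre α l n).natDegree = n :=
  natDegree_eq_of_le_of_coeff_ne_zero (natDegree_monicLaguerre_le α l n)
    (coeff_monicLaguerre_self hα hl n ▸ one_ne_zero)

theorem coeff_monicLaguerre_mul_weightFunctional (hα : -1 < α) (hν : 0 < ν) (hl : 0 < l)
    {n k : ℕ} (hk : k ≤ n) (j : ℕ) :
    (monicLaguerre α l n).coeff k * weightFunctional α ν l 0 (X ^ (k + j)) =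
      Real.Gamma (n + α + 1) * Real.Gamma ν * l ^ (-(n + j + α + 1)) *
        (((-1 : ℤ) ^ (n - k) * n.choose k) • (ascPochhammer ℝ j).eval (α + 1 + k • (1 : ℝ))) := by
  have hpos : 0 < k + α + 1 := add_comm α k ▸ add_natCast_add_one_pos hα k
  have hG := (Real.Gamma_pos_of_pos hpos).ne'
  have hpow : l ^ (-(k + α + 1 + j)) * (l ^ k / l ^ n) = l ^ (-(n + j + α + 1)) := by
    rw [← Real.rpow_natCast l k, ← Real.rpow_natCast l n, ← Real.rpow_sub hl, ← Real.rpow_add hl]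
    ring_nf
  have hsign : (-1 : ℝ) ^ n * (-1) ^ k = (-1) ^ (n - k) := by
    obtain ⟨m, rfl⟩ := Nat.exists_eq_add_of_le' hk
    rw [Nat.add_sub_cancel, pow_add, mul_assoc, ← mul_pow, neg_one_mul, neg_neg, one_pow, mul_one]
  rw [weightFunctional_X_pow, mellinRho_zero_right hν, coeff_monicLaguerre, coeff_laguerre,
    if_pos hk, show α + (k + j : ℕ) + 1 = k + α + 1 + j by push_cast; ring,
    Gamma_add_natCast hpos, show α + 1 + k • (1 : ℝ) = k + α + 1 by rw [nsmul_one]; ring, ← hpow,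
    zsmul_eq_mul]
  push_cast [Nat.cast_choose ℝ hk]
  rw [← hsign]
  field_simp

theorem weightFunctional_monicLaguerre_mul (hα : -1 < α) (hν : 0 < ν) (hl : 0 < l) (n j : ℕ) :
    weightFunctional α ν l 0 (monicLaguerre α l n * X ^ j) =
      Real.Gamma (n + α + 1) * Real.Gamma ν * l ^ (-(n + j + α + 1)) *
        (fwdDiff 1)^[n] (ascPochhammer ℝ j).eval (α + 1) := by
  conv_lhs => rw [as_sum_range_C_mul_X_pow (monicLaguerre α l n), natDegree_monicLaguerre hα hl]
  rw [fwdDiff_iter_eq_sum_shift, Finset.sum_mul, map_sum, Finset.mul_sum]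
  refine Finset.sum_congr rfl fun k hk => ?_
  rw [mul_assoc, ← pow_add, ← smul_eq_C_mul, map_smul, smul_eq_mul,
    coeff_monicLaguerre_mul_weightFunctional hα hν hl (Finset.mem_range_succ_iff.1 hk)]

theorem monicOrthogonal_weightFunctional_zero_right (hα : -1 < α) (hν : 0 < ν) (hl : 0 < l)
    (n : ℕ) : monicOrthogonal (weightFunctional α ν l 0) n = monicLaguerre α l n := by
  refine ((IsAdmissible.of_left_pos hα hν hl le_rfl).isQuasiDefinite.eq_monicOrthogonal
    (monic_monicLaguerre hα hl n) (natDegree_monicLaguerre hα hl n) fun k hk => ?_).symm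
  rw [weightFunctional_monicLaguerre_mul hα hν hl, fwdDiff_iter_eq_zero_of_degree_lt
    ((ascPochhammer_natDegree ℝ k).trans_lt hk), Pi.zero_apply, mul_zero]

theorem sqNorm_weightFunctional_zero_right (hα : -1 < α) (hν : 0 < ν) (hl : 0 < l) (n : ℕ) :
    sqNorm (weightFunctional α ν l 0) n =
      n ! * Real.Gamma (n + α + 1) * Real.Gamma ν * l ^ (-(2 * n + α + 1)) := by
  have hdiff := congrFun (fwdDiff_iter_degree_eq_factorial (ascPochhammer ℝ n)) (α + 1)
  rw [ascPochhammer_natDegree, (monic_ascPochhammer ℝ n).leadingCoeff, one_smul] at hdiff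
  rw [← (IsAdmissible.of_left_pos hα hν hl le_rfl).isQuasiDefinite.apply_mul_of_monic
    (monic_X_pow n) (natDegree_X_pow n), monicOrthogonal_weightFunctional_zero_right hα hν hl,
    weightFunctional_monicLaguerre_mul hα hν hl, hdiff, Pi.natCast_apply]
  ring_nf

theorem a_zero_right (hα : -1 < α) (hν : 0 < ν) (hl : 0 < l) (n : ℕ) :
    a α ν l 0 n = (-1) ^ n * l ^ ((n : ℝ) + (1 + α) / 2) /
      Real.sqrt ((n ! : ℕ) * Real.Gamma (n + α + 1) * Real.Gamma ν) := by
  have hG := Gamma_natCast_add_pos hα n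
  have hsqrt : √(l ^ (-(2 * n + α + 1))) = (l ^ (n + (1 + α) / 2))⁻¹ := by
    rw [Real.sqrt_eq_rpow, ← Real.rpow_mul hl.le, ← Real.rpow_neg hl.le]
    ring_nf
  rw [(IsAdmissible.of_left_pos hα hν hl le_rfl).a_eq, leadCoeff,
    sqNorm_weightFunctional_zero_right hα hν hl, Real.sqrt_mul (by positivity), hsqrt, ← div_div,
    div_inv_eq_mul, div_mul_eq_mul_div]

theorem inv_a_zero_right (hα : -1 < α) (hν : 0 < ν) (hl : 0 < l) (n : ℕ) :
    (a α ν l 0 n)⁻¹ = (-1) ^ n * l ^ (-(n : ℝ) - (1 + α) / 2) *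
      Real.sqrt ((n ! : ℕ) * Real.Gamma (n + α + 1) * Real.Gamma ν) := by
  rw [a_zero_right hα hν hl, inv_div, ← neg_add', Real.rpow_neg hl.le, div_eq_mul_inv, mul_inv,
    ← inv_pow, inv_neg_one, mul_comm]

theorem P_zero_right (hα : -1 < α) (hν : 0 < ν) (hl : 0 < l) (n : ℕ) :
    P α ν l 0 n = modLaguerre α ν l n := by
  have h := IsAdmissible.of_left_pos hα hν hl le_rfl
  have hG := Gamma_natCast_add_pos hα n
  have hsign : ((-1 : ℝ) ^ n) ^ 2 = 1 := by rw [pow_right_comm, neg_one_sq, one_pow]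
  have hsqrt : √(n ! / (Real.Gamma (n + α + 1) * Real.Gamma ν)) =
      n ! / √(n ! * Real.Gamma (n + α + 1) * Real.Gamma ν) := by
    have hn : (0 : ℝ) ≤ n ! := Nat.cast_nonneg _
    rw [mul_assoc, Real.sqrt_mul hn, Real.sqrt_div hn, ← div_div, Real.div_sqrt]
  rw [h.P_eq, orthonormalPoly, ← h.a_eq, a_zero_right hα hν hl,
    monicOrthogonal_weightFunctional_zero_right hα hν hl, monicLaguerre, modLaguerre, ← mul_assoc,
    ← C_mul, hsqrt, Real.rpow_add hl, Real.rpow_natCast]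
  congr 2
  field_simp
  exact hsign

end Laguerre

end

end PrudnikovLaguerre

theorem theorem4 (α ν l t : ℝ) (n : ℕ) (hα : -1 < α) (hν : 0 < ν) (hl : 0 ≤ l) (ht : 0 ≤ t)
    (hlt : l ^ 2 + t ^ 2 ≠ 0) (hn : 1 ≤ n) :
    -- the `P_m` are the orthonormal polynomials of the weight
    ((∀ m : ℕ, (PrudnikovLaguerre.P α ν l t m).natDegree = m ∧
        0 < (-1) ^ m * PrudnikovLaguerre.a α ν l t m) ∧
      (∀ m k : ℕ,
        IntegrableOn (fun x : ℝ => (PrudnikovLaguerre.P α ν l t m).eval x *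
          (PrudnikovLaguerre.P α ν l t k).eval x * PrudnikovLaguerre.weight α ν l t x)
          (Set.Ioi 0) ∧
        ∫ x in Set.Ioi (0 : ℝ), (PrudnikovLaguerre.P α ν l t m).eval x *
          (PrudnikovLaguerre.P α ν l t k).eval x * PrudnikovLaguerre.weight α ν l t x
          = if m = k then 1 else 0)) ∧
    -- the integral-difference equation in `l`
    (0 < t →
      IntervalIntegrable (fun y : ℝ => PrudnikovLaguerre.B α ν y t n) volume 0 l ∧
      ∀ x : ℝ,
        IntervalIntegrable (fun ξ : ℝ =>
          Real.exp (1 / 2 * ∫ y in ξ..l, PrudnikovLaguerre.B α ν y t n) *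
            PrudnikovLaguerre.A α ν ξ t n * (PrudnikovLaguerre.P α ν ξ t (n - 1)).eval x)
          volume 0 l ∧
        (PrudnikovLaguerre.P α ν l t n).eval x =
          (∫ ξ in (0 : ℝ)..l,
            Real.exp (1 / 2 * ∫ y in ξ..l, PrudnikovLaguerre.B α ν y t n) *
              PrudnikovLaguerre.A α ν ξ t n * (PrudnikovLaguerre.P α ν ξ t (n - 1)).eval x) +
          Real.exp (1 / 2 * ∫ y in (0 : ℝ)..l, PrudnikovLaguerre.B α ν y t n) *
            (PrudnikovLaguerre.P α ν 0 t n).eval x) ∧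
    -- the integral-difference equation in `t`
    (0 < l →
      PrudnikovLaguerre.P α ν l 0 n = PrudnikovLaguerre.modLaguerre α ν l n ∧
      PrudnikovLaguerre.a α ν l 0 n =
        (-1) ^ n * l ^ ((n : ℝ) + (1 + α) / 2) /
          Real.sqrt ((n ! : ℕ) * Real.Gamma (n + α + 1) * Real.Gamma ν) ∧
      ∀ x : ℝ,
        IntervalIntegrable (fun y : ℝ =>
          (x * (PrudnikovLaguerre.P α ν l y n).derivative.eval x
            - n * (PrudnikovLaguerre.P α ν l y n).eval x
            - l * PrudnikovLaguerre.A α ν l y n *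
                (PrudnikovLaguerre.P α ν l y (n - 1)).eval x) /
            (y * PrudnikovLaguerre.a α ν l y n)) volume 0 t ∧
        (PrudnikovLaguerre.P α ν l t n).eval x =
          PrudnikovLaguerre.a α ν l t n *
            (∫ y in (0 : ℝ)..t,
              (x * (PrudnikovLaguerre.P α ν l y n).derivative.eval x
                - n * (PrudnikovLaguerre.P α ν l y n).eval x
                - l * PrudnikovLaguerre.A α ν l y n *
                    (PrudnikovLaguerre.P α ν l y (n - 1)).eval x) /
                (y * PrudnikovLaguerre.a α ν l y n)) +
          (-1) ^ n * l ^ (-(n : ℝ) - (1 + α) / 2) *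
            Real.sqrt ((n ! : ℕ) * Real.Gamma (n + α + 1) * Real.Gamma ν) *
            PrudnikovLaguerre.a α ν l t n *
            (PrudnikovLaguerre.modLaguerre α ν l n).eval x) := by
  obtain ⟨n, rfl⟩ := Nat.exists_eq_add_of_le' hn
  have hadd : 0 < l + t := by
    contrapose! hlt
    obtain ⟨rfl, rfl⟩ := (add_eq_zero_iff_of_nonneg hl ht).1 (hlt.antisymm (add_nonneg hl ht))
    norm_num
  have h : PrudnikovLaguerre.IsAdmissible α ν l t := ⟨hα, hν, hl, ht, hadd⟩
  rw [Nat.add_sub_cancel]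
  refine ⟨⟨fun m => ⟨h.natDegree_P m, h.neg_one_pow_mul_a_pos m⟩,
      fun m k => ⟨h.integrableOn_P_mul_P_mul_weight m k, h.integral_P_mul_P_mul_weight m k⟩⟩,
    fun ht => ⟨PrudnikovLaguerre.intervalIntegrable_B_left hα hν ht hl (n + 1),
      fun x => ⟨PrudnikovLaguerre.intervalIntegrable_exp_mul_A_mul_P hα hν ht hl n x,
        PrudnikovLaguerre.eval_P_eq_integral_left hα hν ht hl n x⟩⟩,
    fun hl => ⟨PrudnikovLaguerre.P_zero_right hα hν hl (n + 1),
      PrudnikovLaguerre.a_zero_right hα hν hl (n + 1),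
      fun x => ⟨PrudnikovLaguerre.intervalIntegrable_right hα hν hl ht n x, ?_⟩⟩⟩
  rw [← PrudnikovLaguerre.P_zero_right hα hν hl, ← PrudnikovLaguerre.inv_a_zero_right hα hν hl]
  exact PrudnikovLaguerre.eval_P_eq_integral_right hα hν hl ht n x
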